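/- Let $n\ge 1$, let $W\sim\mathcal N(0,I_n)$, and for a positive semidefinite $\Sigma_X\in\mathbb R^{n\times n}$ with eigenvalues $\lambda_1,\dots,\lambda_n\ge 0$ put $d_{\Sigma_X}(w,v)=(w-v)^\top\Sigma_X(w-v)$ for $w,v\in\mathbb R^n$. A compression scheme of rate $R$ consists of a measurable encoder $f:\mathbb R^n\to\{1,\dots,\lfloor 2^{nR}\rfloor\}$ and a decoder $g:\{1,\dots,\lfloor 2^{nR}\rfloor\}\to\mathbb R^n$; both may depend on $\Sigma_X$. Write $\log=\log_2$ and, for $t>0$, $$D_{\mathrm{wf}}(\Sigma_X,t)=\frac1n\sum_{i=1}^n\min\{\lambda_i,t\},\qquad R_{\mathrm{wf}}(\Sigma_X,t)=\frac1{2n}\sum_{i=1}^n\max\Big\{0,\log\frac{\lambda_i}{t}\Big\}$$ (with $\log 0=-\infty$). The waterfilling distortion is $\mathbf D_{\mathrm{wf}}(R,\Sigma_X)=D_{\mathrm{wf}}(\Sigma_X,t)$ for any $t>0$ with $R_{\mathrm{wf}}(\Sigma_X,t)=R$ (the value does not depend on the choice of $t$); if there is no such $t$, which happens only if $R<0$ or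 $\Sigma_X=0$, then $\mathbf D_{\mathrm{wf}}(R,\Sigma_X)=\frac1n\operatorname{tr}\Sigma_X$. (i) For every $n\ge1$, every positive semidefinite $\Sigma_X$, every $R$ and every compression scheme $(f,g)$ of rate $R$, $$\mathbb E\big[d_{\Sigma_X}(W,g(f(W)))\big]\ \ge\ n\,\mathbf D_{\mathrm{wf}}(R,\Sigma_X).$$ (ii) Conversely, for every $B>0$ there is a constant $c=c(B)>0$ such that for every $n\ge1$, every $R\ge0$ and every positive semidefinite $\Sigma_X\in\mathbb R^{n\times n}$ there is a compression scheme $(f,g)$ of rate $R$ (depending on $\Sigma_X$) with $$\mathbb E\big[d_{\Sigma_X}(W,g(f(W)))\big]\ \le\ n\,\mathbf D_{\mathrm{wf}}\Big(R-c\sqrt{\tfrac{\log n}{n}},\ \Sigma_X\Big)+c\,n^{-B}\operatorname{tr}\Sigma_X.$$ -/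

import Mathlib

open MeasureTheory ProbabilityTheory
open scoped Matrix

noncomputable section

/-- The quadratic distortion `d_Σ(w, v) = (w - v)ᵀ Σ (w - v)` on `ℝⁿ`. -/
def quadDist {n : ℕ} (S : Matrix (Fin n) (Fin n) ℝ) (w v : EuclideanSpace ℝ (Fin n)) : ℝ :=
  (fun i => w i - v i) ⬝ᵥ (S *ᵥ (fun i => w i - v i))

/-- An `(n, R)` quantization scheme: a (measurable) encoder `f : ℝⁿ → [2^{nR}]` and a decoder
`g : [2^{nR}] → ℝⁿ`, where `[x] = {1, …, ⌊x⌋}` is modelled by `Fin ⌊x⌋₊`. The rate `R` is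
measured in bits per coordinate. -/
structure QuantScheme (n : ℕ) (R : ℝ) where
  /-- the encoder `f` -/
  enc : EuclideanSpace ℝ (Fin n) → Fin ⌊(2 : ℝ) ^ ((n : ℝ) * R)⌋₊
  /-- the decoder `g` -/
  dec : Fin ⌊(2 : ℝ) ^ ((n : ℝ) * R)⌋₊ → EuclideanSpace ℝ (Fin n)
  measurable_enc : Measurable enc

/-- The expected distortion `𝔼[d_Σ(W, g(f(W)))]` with `W ∼ N(0, I_n)`. The integrand is
integrable whenever `Σ` is positive semidefinite, see `integrable_quadDist_scheme`. -/
def QuantScheme.expDist {n : ℕ} {R : ℝ} (q : QuantScheme n R)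
    (S : Matrix (Fin n) (Fin n) ℝ) : ℝ :=
  ∫ w, quadDist S w (q.dec (q.enc w)) ∂(stdGaussian (EuclideanSpace ℝ (Fin n)))

/-- The distortion `(1/n) ∑ᵢ min {λᵢ, t}` at water level `t`. -/
def wfDistAt {n : ℕ} {S : Matrix (Fin n) (Fin n) ℝ} (hS : S.PosSemidef) (t : ℝ) : ℝ :=
  (1 / (n : ℝ)) * ∑ i, min (hS.isHermitian.eigenvalues i) t

/-- The rate `(1/(2n)) ∑ᵢ max {0, log₂ (λᵢ / t)}` at water level `t > 0`. (For `λᵢ = 0` the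
summand is `0`, in accordance with `log 0 = -∞`.) -/
def wfRateAt {n : ℕ} {S : Matrix (Fin n) (Fin n) ℝ} (hS : S.PosSemidef) (t : ℝ) : ℝ :=
  (1 / (2 * (n : ℝ))) * ∑ i, max 0 (Real.logb 2 (hS.isHermitian.eigenvalues i / t))

open Classical in
/-- The waterfilling distortion as a function of the rate: the distortion at a water level `t > 0`
whose rate is `R`; it does not depend on the choice of `t`, see `wfDist_eq`. A level fails to exist
only if `R < 0`, or if `Σ = 0` and `R ≠ 0`; the value is then `tr Σ / n`, the distortion at rate
zero (in particular it is `0` for `Σ = 0`). -/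
def wfDist {n : ℕ} (R : ℝ) {S : Matrix (Fin n) (Fin n) ℝ} (hS : S.PosSemidef) : ℝ :=
  if h : ∃ t : ℝ, 0 < t ∧ wfRateAt hS t = R then wfDistAt hS h.choose else S.trace / n

end

theorem wfDistAt_eq_of_wfRateAt_eq {n : ℕ} {S : Matrix (Fin n) (Fin n) ℝ} (hS : S.PosSemidef)
    {s t : ℝ} (hs : 0 < s) (hst : s ≤ t) (h : wfRateAt hS s = wfRateAt hS t) :
    wfDistAt hS s = wfDistAt hS t := by
  rcases Nat.eq_zero_or_pos n with rfl | hn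
  · simp [wfDistAt]
  have ht : 0 < t := hs.trans_le hst
  have hn' : (0 : ℝ) < n := by exact_mod_cast hn
  unfold wfRateAt at h
  have h' := mul_left_cancel₀ (by positivity) h
  have hmono : ∀ i ∈ Finset.univ, max 0 (Real.logb 2 (hS.isHermitian.eigenvalues i / t)) ≤
      max 0 (Real.logb 2 (hS.isHermitian.eigenvalues i / s)) := by
    intro i _
    rcases (hS.eigenvalues_nonneg i).eq_or_lt with h0 | h0
    · simp [← h0]
    · exact max_le_max le_rfl (Real.logb_le_logb_of_le one_lt_two (by positivity) (by gcongr))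
  have heq := (Finset.sum_eq_sum_iff_of_le hmono).1 h'.symm
  unfold wfDistAt
  congr 1
  refine Finset.sum_congr rfl fun i hi => ?_
  have hi' := heq i hi
  rcases le_or_gt (hS.isHermitian.eigenvalues i) s with hle | hgt
  · rw [min_eq_left hle, min_eq_left (hle.trans hst)]
  · have h0 : 0 < hS.isHermitian.eigenvalues i := hs.trans hgt
    have hpos : 0 < Real.logb 2 (hS.isHermitian.eigenvalues i / s) :=
      Real.logb_pos one_lt_two ((one_lt_div hs).2 hgt)
    rw [max_eq_right hpos.le] at hi'
    have hpos' : 0 < Real.logb 2 (hS.isHermitian.eigenvalues i / t) := by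
      by_contra hcon
      rw [max_eq_left (not_lt.1 hcon)] at hi'
      exact hpos.ne hi'
    rw [max_eq_right hpos'.le] at hi'
    have := Real.logb_injOn_pos one_lt_two (Set.mem_Ioi.2 (div_pos h0 ht))
      (Set.mem_Ioi.2 (div_pos h0 hs)) hi'
    have hst' : t = s := by
      field_simp at this
      linarith
    rw [hst']

/-- `wfDist` is well defined: every water level of rate `R` gives the same distortion. -/
theorem wfDist_eq {n : ℕ} {R : ℝ} {S : Matrix (Fin n) (Fin n) ℝ} (hS : S.PosSemidef)
    {t : ℝ} (ht : 0 < t) (h : wfRateAt hS t = R) : wfDist R hS = wfDistAt hS t := by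
  have hex : ∃ t : ℝ, 0 < t ∧ wfRateAt hS t = R := ⟨t, ht, h⟩
  rw [wfDist, dif_pos hex]
  obtain ⟨h1, h2⟩ := hex.choose_spec
  rcases le_total hex.choose t with hle | hle
  · exact wfDistAt_eq_of_wfRateAt_eq hS h1 hle (h2.trans h.symm)
  · exact (wfDistAt_eq_of_wfRateAt_eq hS ht hle (h.trans h2.symm)).symm

theorem quadDist_nonneg {n : ℕ} {S : Matrix (Fin n) (Fin n) ℝ} (hS : S.PosSemidef)
    (w v : EuclideanSpace ℝ (Fin n)) : 0 ≤ quadDist S w v := by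
  simpa [quadDist] using hS.dotProduct_mulVec_nonneg (fun i => w i - v i)

theorem integrable_quadDist {n : ℕ} (S : Matrix (Fin n) (Fin n) ℝ)
    (v : EuclideanSpace ℝ (Fin n)) :
    Integrable (fun w => quadDist S w v) (stdGaussian (EuclideanSpace ℝ (Fin n))) := by
  have hL : ∀ i, MemLp (fun w : EuclideanSpace ℝ (Fin n) => w i - v i) 2
      (stdGaussian (EuclideanSpace ℝ (Fin n))) := fun i =>
    (IsGaussian.memLp_dual (stdGaussian (EuclideanSpace ℝ (Fin n)))
      (EuclideanSpace.proj i) 2 (by simp)).sub (memLp_const (v i))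
  simp only [quadDist, dotProduct, Matrix.mulVec, Finset.mul_sum]
  refine integrable_finsetSum _ fun i _ => integrable_finsetSum _ fun j _ => ?_
  have := ((hL i).integrable_mul (hL j)).const_mul (S i j)
  refine this.congr (Filter.Eventually.of_forall fun w => ?_)
  simp only [Pi.mul_apply]
  ring

theorem integrable_quadDist_scheme {n : ℕ} {R : ℝ} {S : Matrix (Fin n) (Fin n) ℝ}
    (hS : S.PosSemidef) (q : QuantScheme n R) :
    Integrable (fun w => quadDist S w (q.dec (q.enc w)))
      (stdGaussian (EuclideanSpace ℝ (Fin n))) := by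
  have hm : Measurable fun w => q.dec (q.enc w) :=
    (measurable_of_countable q.dec).comp q.measurable_enc
  refine (integrable_finsetSum Finset.univ fun m _ => integrable_quadDist S (q.dec m)).mono'
    (Measurable.aestronglyMeasurable ?_) (Filter.Eventually.of_forall fun w => ?_)
  · simp only [quadDist, dotProduct, Matrix.mulVec]
    fun_prop
  · rw [Real.norm_of_nonneg (quadDist_nonneg hS _ _)]
    exact Finset.single_le_sum (f := fun m => quadDist S w (q.dec m))
      (fun m _ => quadDist_nonneg hS _ _) (Finset.mem_univ (q.enc w))

/-!
In an eigenbasis of `S` the problem is to reproduce independent standard Gaussians under the squared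
error with weights `λ i`.

For the converse, let `U y x` be a function of source `x` and reproduction `y` with
`∫ exp (U y x) ≤ 1` for every `y`. Bounding the exponential of the chosen term by the sum over all
reproductions and applying Jensen's inequality gives `∫ U (y x) x ≤ log M` for every scheme with `M`
reproductions. The product of the tilts `waterTilt`, which are information densities of Gaussian
channels in the coordinates above the water level, is such a function, and its mean is the
waterfilling rate plus the distortion gap divided by `2 t`.

For achievability, the coordinates with `λ i > t` are covered greedily: on its typical set, the
Gaussian test channel with noise variances slightly below `t / λ i` has density at most
`K = exp (rate + O(√(n log n)))` with respect to the product of its marginals, so some codeword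
always covers about a fraction `1 / K` of what is still uncovered, and slightly more than `K`
codewords cover all but a set of probability `O(n ^ (-2 B))`. Reproducing the exceptional set by `0`
costs at most `O(n ^ (-B)) * trace S`, by the Cauchy-Schwarz inequality.
-/

open scoped NNReal ENNReal

/-- The law of a family of independent standard Gaussian variables indexed by `ι`. -/
noncomputable abbrev piGaussian (ι : Type*) [Fintype ι] : Measure (ι → ℝ) :=
  Measure.pi fun _ => gaussianReal 0 1

section WeightedSqDist

variable {ι : Type*} [Fintype ι]

/-- The squared distance of `w` and `v` with coordinate weights `l`. In coordinates with respect to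
an eigenbasis of `S` this is the distortion `quadDist S`. -/
def weightedSqDist (l w v : ι → ℝ) : ℝ :=
  ∑ i, l i * (w i - v i) ^ 2

lemma weightedSqDist_nonneg {l : ι → ℝ} (hl : ∀ i, 0 ≤ l i) (w v : ι → ℝ) :
    0 ≤ weightedSqDist l w v :=
  Finset.sum_nonneg fun i _ => mul_nonneg (hl i) (sq_nonneg _)

lemma weightedSqDist_zero_right (l w : ι → ℝ) :
    weightedSqDist l w 0 = ∑ i, l i * w i ^ 2 := by
  simp [weightedSqDist]

@[fun_prop]
lemma measurable_weightedSqDist {α : Type*} [MeasurableSpace α] (l : ι → ℝ) {f g : α → ι → ℝ}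
    (hf : Measurable f) (hg : Measurable g) :
    Measurable fun x => weightedSqDist l (f x) (g x) := by
  unfold weightedSqDist
  fun_prop

end WeightedSqDist

section Eigencoordinates

variable {n : ℕ} {S : Matrix (Fin n) (Fin n) ℝ}

/-- The coordinates of a vector with respect to the eigenbasis of a symmetric matrix. -/
noncomputable def eigenCoord (hS : S.IsHermitian) : EuclideanSpace ℝ (Fin n) ≃ᵐ (Fin n → ℝ) :=
  hS.eigenvectorBasis.repr.toHomeomorph.toMeasurableEquiv.trans
    (MeasurableEquiv.toLp 2 (Fin n → ℝ)).symm

lemma eigenCoord_apply (hS : S.IsHermitian) (w : EuclideanSpace ℝ (Fin n)) (i : Fin n) :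
    eigenCoord hS w i = inner ℝ (hS.eigenvectorBasis i) w :=
  hS.eigenvectorBasis.repr_apply_apply w i

lemma measurePreserving_eigenCoord (hS : S.IsHermitian) :
    MeasurePreserving (eigenCoord hS) (stdGaussian (EuclideanSpace ℝ (Fin n)))
      (piGaussian (Fin n)) := by
  have hrepr : MeasurePreserving hS.eigenvectorBasis.repr
      (stdGaussian (EuclideanSpace ℝ (Fin n))) (stdGaussian (EuclideanSpace ℝ (Fin n))) :=
    ⟨hS.eigenvectorBasis.repr.continuous.measurable, stdGaussian_map _⟩
  have hcoord : MeasurePreserving (MeasurableEquiv.toLp 2 (Fin n → ℝ))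
      (piGaussian (Fin n)) (stdGaussian (EuclideanSpace ℝ (Fin n))) :=
    ⟨MeasurableEquiv.measurable _, map_pi_eq_stdGaussian⟩
  exact (hcoord.symm _).comp hrepr

lemma inner_eigenvectorBasis_toEuclideanLin (hS : S.IsHermitian) (x : EuclideanSpace ℝ (Fin n))
    (i : Fin n) :
    inner ℝ (hS.eigenvectorBasis i) (Matrix.toEuclideanLin S x) =
      hS.eigenvalues i * inner ℝ (hS.eigenvectorBasis i) x := by
  have heig : Matrix.toEuclideanLin S (hS.eigenvectorBasis i) =
      hS.eigenvalues i • hS.eigenvectorBasis i := by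
    ext j
    simpa [Matrix.toLpLin_apply] using congrFun (hS.mulVec_eigenvectorBasis i) j
  rw [← Matrix.isSymmetric_toEuclideanLin_iff.mpr hS, heig, real_inner_smul_left]

lemma quadDist_eq_weightedSqDist (hS : S.IsHermitian) (w v : EuclideanSpace ℝ (Fin n)) :
    quadDist S w v = weightedSqDist hS.eigenvalues (eigenCoord hS w) (eigenCoord hS v) := by
  have hinner : quadDist S w v = inner ℝ (w - v) (Matrix.toEuclideanLin S (w - v)) := by
    simp [quadDist, PiLp.inner_apply, dotProduct, Matrix.toLpLin_apply, mul_comm, Pi.sub_def]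
  rw [hinner, ← hS.eigenvectorBasis.sum_inner_mul_inner, weightedSqDist]
  refine Finset.sum_congr rfl fun i _ => ?_
  rw [inner_eigenvectorBasis_toEuclideanLin, eigenCoord_apply, eigenCoord_apply, ← inner_sub_right,
    real_inner_comm]
  ring

lemma integral_quadDist_eq_integral_weightedSqDist (hS : S.IsHermitian)
    (φ : EuclideanSpace ℝ (Fin n) → EuclideanSpace ℝ (Fin n)) :
    ∫ w, quadDist S w (φ w) ∂stdGaussian (EuclideanSpace ℝ (Fin n)) =
      ∫ x, weightedSqDist hS.eigenvalues x (eigenCoord hS (φ ((eigenCoord hS).symm x)))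
        ∂piGaussian (Fin n) := by
  rw [← (measurePreserving_eigenCoord hS).integral_comp' (g := fun x =>
    weightedSqDist hS.eigenvalues x (eigenCoord hS (φ ((eigenCoord hS).symm x))))]
  simp only [quadDist_eq_weightedSqDist hS, MeasurableEquiv.symm_apply_apply]

lemma trace_eq_sum_eigenvalues_real (hS : S.IsHermitian) : S.trace = ∑ i, hS.eigenvalues i := by
  simpa using hS.trace_eq_sum_eigenvalues

end Eigencoordinates

section Waterfilling

variable {ι : Type*} [Fintype ι]

/-- The total waterfilling rate `∑ᵢ max {0, log (lᵢ / t)} / 2` at level `t`, measured in nats. -/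
noncomputable def waterNats (l : ι → ℝ) (t : ℝ) : ℝ :=
  ∑ i, max 0 (Real.log (l i / t)) / 2

lemma waterNats_nonneg (l : ι → ℝ) (t : ℝ) : 0 ≤ waterNats l t :=
  Finset.sum_nonneg fun _ _ => div_nonneg (le_max_left _ _) zero_le_two

lemma continuousOn_waterNats (l : ι → ℝ) : ContinuousOn (waterNats l) (Set.Ioi 0) := by
  refine continuousOn_finsetSum _ fun i _ => ContinuousOn.div_const ?_ 2
  rcases eq_or_ne (l i) 0 with h0 | h0
  · simp only [h0, zero_div, Real.log_zero]
    exact continuousOn_const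
  · exact continuousOn_const.sup <|
      (continuousOn_const.div continuousOn_id fun _ ht => ne_of_gt ht).log fun _ ht =>
        div_ne_zero h0 (ne_of_gt ht)

lemma exists_waterNats_eq {l : ι → ℝ} (hl : ∀ i, 0 ≤ l i) {j : ι} (hj : 0 < l j)
    {r : ℝ} (hr : 0 ≤ r) : ∃ t, 0 < t ∧ waterNats l t = r := by
  set low := l j * Real.exp (-(2 * r))
  set high := ∑ i, l i
  have hle_high : ∀ i, l i ≤ high := fun i =>
    Finset.single_le_sum (fun i _ => hl i) (Finset.mem_univ i)
  have hlow : 0 < low := by positivity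
  have hlow_le : low ≤ high :=
    (mul_le_of_le_one_right hj.le (Real.exp_le_one_iff.2 (by linarith))).trans (hle_high j)
  have hrate_high : waterNats l high = 0 := Finset.sum_eq_zero fun i _ => by
    rw [max_eq_left (Real.log_nonpos (div_nonneg (hl i) (hlow.le.trans hlow_le))
      (div_le_one_of_le₀ (hle_high i) (hlow.le.trans hlow_le))), zero_div]
  have hrate_low : r ≤ waterNats l low := by
    have hlog : Real.log (l j / low) = 2 * r := by
      rw [div_mul_cancel_left₀ hj.ne', ← Real.exp_neg, Real.log_exp, neg_neg]
    calc r = Real.log (l j / low) / 2 := by rw [hlog]; ring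
      _ ≤ max 0 (Real.log (l j / low)) / 2 := by gcongr; exact le_max_right _ _
      _ ≤ waterNats l low := Finset.single_le_sum (f := fun i => max 0 (Real.log (l i / low)) / 2)
        (fun _ _ => div_nonneg (le_max_left _ _) zero_le_two) (Finset.mem_univ j)
  obtain ⟨t, ht, htr⟩ := intermediate_value_Icc' hlow_le
    ((continuousOn_waterNats l).mono fun t ht => hlow.trans_le ht.1)
    ⟨hrate_high.trans_le hr, hrate_low⟩
  exact ⟨t, hlow.trans_le ht.1, htr⟩

variable {n : ℕ} {S : Matrix (Fin n) (Fin n) ℝ}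

lemma mul_wfDistAt (hS : S.PosSemidef) (t : ℝ) :
    n * wfDistAt hS t = ∑ i, min (hS.isHermitian.eigenvalues i) t := by
  rcases eq_or_ne n 0 with rfl | hn
  · simp
  · rw [wfDistAt, ← mul_assoc, mul_one_div_cancel (by exact_mod_cast hn), one_mul]

lemma mul_wfRateAt_mul_log_two (hS : S.PosSemidef) (t : ℝ) :
    n * wfRateAt hS t * Real.log 2 = waterNats hS.isHermitian.eigenvalues t := by
  rcases eq_or_ne n 0 with rfl | hn
  · simp [waterNats]
  have hlog (x : ℝ) : max 0 (Real.log x) = max 0 (Real.logb 2 x) * Real.log 2 := by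
    rw [max_mul_of_nonneg _ _ (Real.log_nonneg one_le_two), zero_mul, Real.logb,
      div_mul_cancel₀ _ (Real.log_pos one_lt_two).ne']
  simp only [waterNats, hlog]
  rw [← Finset.sum_div, ← Finset.sum_mul, wfRateAt]
  field_simp

lemma exists_wfRateAt_eq (hS : S.PosSemidef) (hS0 : S ≠ 0) {R : ℝ} (hR : 0 ≤ R) :
    ∃ t, 0 < t ∧ wfRateAt hS t = R := by
  obtain ⟨j, hj⟩ : ∃ j, 0 < hS.isHermitian.eigenvalues j := by
    by_contra! hnonpos
    exact hS0 (hS.isHermitian.eigenvalues_eq_zero_iff.1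
      (funext fun j => (hnonpos j).antisymm (hS.eigenvalues_nonneg j)))
  have hn : (n : ℝ) ≠ 0 := by exact_mod_cast j.pos.ne'
  obtain ⟨t, ht, htR⟩ := exists_waterNats_eq hS.eigenvalues_nonneg hj
    (r := n * R * Real.log 2) (by positivity)
  rw [← mul_wfRateAt_mul_log_two hS] at htR
  exact ⟨t, ht, mul_left_cancel₀ hn (mul_right_cancel₀ (Real.log_pos one_lt_two).ne' htR)⟩

end Waterfilling

section GaussianDensity

/-- The logarithm of the density of `gaussianReal y s` with respect to `gaussianReal 0 1`: the
information density of a Gaussian channel with input `y` and noise variance `s ≠ 0` whose output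
is standard Gaussian. -/
noncomputable def gaussianInfoDensity (y : ℝ) (s : ℝ≥0) (x : ℝ) : ℝ :=
  (x ^ 2 - (x - y) ^ 2 / s - Real.log s) / 2

@[fun_prop]
lemma measurable_gaussianInfoDensity {α : Type*} [MeasurableSpace α] {f g : α → ℝ}
    (hf : Measurable f) (hg : Measurable g) (s : ℝ≥0) :
    Measurable fun a => gaussianInfoDensity (f a) s (g a) := by
  unfold gaussianInfoDensity
  fun_prop

lemma gaussianPDFReal_mul_exp_gaussianInfoDensity (y : ℝ) {s : ℝ≥0} (hs : s ≠ 0) (x : ℝ) :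
    gaussianPDFReal 0 1 x * Real.exp (gaussianInfoDensity y s x) = gaussianPDFReal y s x := by
  have hs' : (0 : ℝ) < s := by positivity
  have hsqrt : Real.exp (-Real.log s / 2) = (√(s : ℝ))⁻¹ := by
    rw [neg_div, Real.exp_neg, ← Real.log_sqrt hs'.le, Real.exp_log (Real.sqrt_pos.2 hs')]
  have hsplit : gaussianInfoDensity y s x =
      -(-x ^ 2 / 2) + -(x - y) ^ 2 / (2 * s) + -Real.log s / 2 := by
    rw [gaussianInfoDensity]
    field_simp
    ring
  simp only [gaussianPDFReal, NNReal.coe_one, mul_one, sub_zero]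
  rw [hsplit, Real.exp_add, Real.exp_add, Real.exp_neg, hsqrt, Real.sqrt_mul' _ hs'.le]
  field_simp

lemma gaussianReal_eq_withDensity (y : ℝ) {s : ℝ≥0} (hs : s ≠ 0) :
    gaussianReal y s = (gaussianReal 0 1).withDensity fun x =>
      ENNReal.ofReal (Real.exp (gaussianInfoDensity y s x)) := by
  rw [gaussianReal_of_var_ne_zero _ hs, gaussianReal_of_var_ne_zero _ one_ne_zero,
    ← withDensity_mul _ (measurable_gaussianPDF _ _) (by fun_prop)]
  congr 1
  ext x
  rw [Pi.mul_apply, gaussianPDF, gaussianPDF, ← ENNReal.ofReal_mul (gaussianPDFReal_nonneg _ _ _),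
    gaussianPDFReal_mul_exp_gaussianInfoDensity y hs]

lemma lintegral_exp_gaussianInfoDensity (y : ℝ) {s : ℝ≥0} (hs : s ≠ 0) :
    ∫⁻ x, ENNReal.ofReal (Real.exp (gaussianInfoDensity y s x)) ∂gaussianReal 0 1 = 1 := by
  rw [← setLIntegral_univ, ← withDensity_apply _ MeasurableSet.univ,
    ← gaussianReal_eq_withDensity y hs, measure_univ]

lemma integrable_exp_gaussianInfoDensity (y : ℝ) {s : ℝ≥0} (hs : s ≠ 0) :
    Integrable (fun x => Real.exp (gaussianInfoDensity y s x)) (gaussianReal 0 1) := by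
  refine ⟨by fun_prop, ?_⟩
  rw [hasFiniteIntegral_iff_ofReal (ae_of_all _ fun _ => (Real.exp_pos _).le),
    lintegral_exp_gaussianInfoDensity y hs]
  exact ENNReal.one_lt_top

lemma integral_exp_gaussianInfoDensity (y : ℝ) {s : ℝ≥0} (hs : s ≠ 0) :
    ∫ x, Real.exp (gaussianInfoDensity y s x) ∂gaussianReal 0 1 = 1 := by
  rw [integral_eq_lintegral_of_nonneg_ae (ae_of_all _ fun _ => (Real.exp_pos _).le) (by fun_prop),
    lintegral_exp_gaussianInfoDensity y hs, ENNReal.toReal_one]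

variable {ι : Type*} [Fintype ι]

lemma pi_withDensity {X : ι → Type*} [∀ i, MeasurableSpace (X i)] (μ : ∀ i, Measure (X i))
    [∀ i, IsProbabilityMeasure (μ i)] {f : ∀ i, X i → ℝ≥0∞} (hf : ∀ i, Measurable (f i))
    [∀ i, SigmaFinite ((μ i).withDensity (f i))] :
    Measure.pi (fun i => (μ i).withDensity (f i)) =
      (Measure.pi μ).withDensity fun x => ∏ i, f i (x i) := by
  refine Measure.pi_eq fun B hB => ?_
  have hind (x : ∀ i, X i) : (Set.univ.pi B).indicator (fun x => ∏ i, f i (x i)) x =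
      ∏ i, (B i).indicator (f i) (x i) := by
    by_cases hx : x ∈ Set.univ.pi B
    · rw [Set.indicator_of_mem hx]
      exact Finset.prod_congr rfl fun i _ => (Set.indicator_of_mem (hx i trivial) _).symm
    · rw [Set.indicator_of_notMem hx]
      simp only [Set.mem_pi, Set.mem_univ, true_implies, not_forall] at hx
      obtain ⟨i, hi⟩ := hx
      exact (Finset.prod_eq_zero (Finset.mem_univ i) (Set.indicator_of_notMem hi _)).symm
  rw [withDensity_apply _ (MeasurableSet.univ_pi hB),
    ← lintegral_indicator (MeasurableSet.univ_pi hB), lintegral_congr hind,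
    lintegral_prod_eq_prod_lintegral_of_indepFun Finset.univ
      (fun i (x : ∀ i, X i) => (B i).indicator (f i) (x i))
      (iIndepFun_pi fun i => ((hf i).indicator (hB i)).aemeasurable)
      fun i => ((hf i).indicator (hB i)).comp (measurable_pi_apply i)]
  refine Finset.prod_congr rfl fun i _ => ?_
  rw [(measurePreserving_eval μ i).lintegral_comp ((hf i).indicator (hB i)),
    lintegral_indicator (hB i), withDensity_apply _ (hB i)]

lemma pi_gaussianReal_eq_withDensity (y : ι → ℝ) {s : ι → ℝ≥0} (hs : ∀ i, s i ≠ 0) :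
    Measure.pi (fun i => gaussianReal (y i) (s i)) =
      (piGaussian ι).withDensity fun x =>
        ENNReal.ofReal (Real.exp (∑ i, gaussianInfoDensity (y i) (s i) (x i))) := by
  have hdens (i : ι) := gaussianReal_eq_withDensity (y i) (hs i)
  have (i : ι) : SigmaFinite ((gaussianReal 0 1).withDensity fun x =>
      ENNReal.ofReal (Real.exp (gaussianInfoDensity (y i) (s i) x))) := by
    rw [← hdens i]
    infer_instance
  simp only [Real.exp_sum, ENNReal.ofReal_prod_of_nonneg fun _ _ => (Real.exp_pos _).le]
  rw [← pi_withDensity (fun _ => gaussianReal 0 1)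
    (f := fun i x => ENNReal.ofReal (Real.exp (gaussianInfoDensity (y i) (s i) x)))
    fun i => by fun_prop]
  exact congrArg Measure.pi (funext hdens)

end GaussianDensity

section GaussianMoments

lemma integral_sq_gaussianReal : ∫ x, x ^ 2 ∂gaussianReal 0 1 = 1 := by
  have hvar := variance_id_gaussianReal (μ := 0) (v := 1)
  rw [variance_of_integral_eq_zero aemeasurable_id (by simp)] at hvar
  simpa using hvar

lemma integrable_pow_gaussianReal (k : ℕ) : Integrable (fun x => x ^ k) (gaussianReal 0 1) := by
  refine (integrable_norm_iff (by fun_prop)).1 ?_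
  simpa using (memLp_id_gaussianReal (μ := 0) (v := 1) (k : ℝ≥0)).integrable_norm_pow'

lemma exp_mul_sq_sub_one_eq {θ : ℝ} (hθ : θ < 1 / 2) (x : ℝ) :
    Real.exp (θ * (x ^ 2 - 1)) = Real.exp (-θ - Real.log (1 - 2 * θ) / 2) *
      Real.exp (gaussianInfoDensity 0 (1 - 2 * θ).toNNReal⁻¹ x) := by
  have hpos : 0 < 1 - 2 * θ := by linarith
  rw [← Real.exp_add, gaussianInfoDensity, NNReal.coe_inv, Real.coe_toNNReal _ hpos.le,
    Real.log_inv, div_inv_eq_mul]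
  ring_nf

lemma toNNReal_one_sub_two_mul_inv_ne_zero {θ : ℝ} (hθ : θ < 1 / 2) :
    (1 - 2 * θ).toNNReal⁻¹ ≠ 0 :=
  inv_ne_zero (Real.toNNReal_pos.2 (by linarith)).ne'

lemma integrable_exp_mul_sq_sub_one {θ : ℝ} (hθ : θ < 1 / 2) :
    Integrable (fun x => Real.exp (θ * (x ^ 2 - 1))) (gaussianReal 0 1) := by
  simp only [exp_mul_sq_sub_one_eq hθ]
  exact (integrable_exp_gaussianInfoDensity 0
    (toNNReal_one_sub_two_mul_inv_ne_zero hθ)).const_mul _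

lemma mgf_sq_sub_one_gaussianReal {θ : ℝ} (hθ : θ < 1 / 2) :
    mgf (fun x => x ^ 2 - 1) (gaussianReal 0 1) θ =
      Real.exp (-θ - Real.log (1 - 2 * θ) / 2) := by
  simp only [mgf, exp_mul_sq_sub_one_eq hθ]
  rw [integral_const_mul,
    integral_exp_gaussianInfoDensity 0 (toNNReal_one_sub_two_mul_inv_ne_zero hθ), mul_one]

lemma mgf_sq_sub_one_gaussianReal_le {θ : ℝ} (hθ : |θ| ≤ 1 / 4) :
    mgf (fun x => x ^ 2 - 1) (gaussianReal 0 1) θ ≤ Real.exp (4 * θ ^ 2) := by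
  obtain ⟨-, hθ'⟩ := abs_le.1 hθ
  have habs : |2 * θ| ≤ 1 / 2 := by
    rw [abs_mul, abs_two]
    linarith
  have hlog : |2 * θ + Real.log (1 - 2 * θ)| ≤ |2 * θ| ^ 2 / (1 - |2 * θ|) := by
    simpa using Real.abs_log_sub_add_sum_range_le (x := 2 * θ) (by linarith) 1
  have hremainder : |2 * θ| ^ 2 / (1 - |2 * θ|) ≤ 8 * θ ^ 2 := by
    rw [div_le_iff₀ (by linarith), sq_abs]
    nlinarith [sq_nonneg θ]
  rw [mgf_sq_sub_one_gaussianReal (by linarith), Real.exp_le_exp]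
  linarith [(abs_le.1 (hlog.trans hremainder)).1]

variable {ι : Type*} [Fintype ι]

lemma integrable_eval_pow_piGaussian (k : ℕ) (i : ι) :
    Integrable (fun x : ι → ℝ => x i ^ k) (piGaussian ι) :=
  integrable_comp_eval (μ := fun _ : ι => gaussianReal 0 1) (i := i)
    (f := fun x => x ^ k) (integrable_pow_gaussianReal k)

lemma integral_eval_piGaussian {f : ℝ → ℝ} (hf : AEStronglyMeasurable f (gaussianReal 0 1))
    (i : ι) : ∫ x : ι → ℝ, f (x i) ∂piGaussian ι = ∫ x, f x ∂gaussianReal 0 1 :=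
  integral_comp_eval (μ := fun _ : ι => gaussianReal 0 1) (i := i) hf

lemma iIndepFun_sq_sub_one_piGaussian :
    iIndepFun (fun i (x : ι → ℝ) => x i ^ 2 - 1) (piGaussian ι) :=
  iIndepFun_pi (X := fun _ x => x ^ 2 - 1) fun _ => by fun_prop

lemma integrable_exp_mul_sum_sq_sub_one {θ : ℝ} (hθ : θ < 1 / 2) :
    Integrable (fun x : ι → ℝ => Real.exp (θ * ∑ i, (x i ^ 2 - 1))) (piGaussian ι) := by
  simpa only [Finset.sum_apply] using
    iIndepFun_sq_sub_one_piGaussian.integrable_exp_mul_sum (t := θ) (s := Finset.univ)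
      (fun i => by fun_prop) fun i _ => integrable_comp_eval
        (μ := fun _ : ι => gaussianReal 0 1) (i := i) (integrable_exp_mul_sq_sub_one hθ)

lemma mgf_sum_sq_sub_one_le {θ : ℝ} (hθ : |θ| ≤ 1 / 4) :
    mgf (fun x : ι → ℝ => ∑ i, (x i ^ 2 - 1)) (piGaussian ι) θ ≤
      Real.exp (4 * Fintype.card ι * θ ^ 2) := by
  have hcoord (i : ι) : mgf (fun x : ι → ℝ => x i ^ 2 - 1) (piGaussian ι) θ ≤
      Real.exp (4 * θ ^ 2) :=
    (integral_eval_piGaussian (f := fun x => Real.exp (θ * (x ^ 2 - 1))) (by fun_prop) i).trans_le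
      (mgf_sq_sub_one_gaussianReal_le hθ)
  calc mgf (fun x : ι → ℝ => ∑ i, (x i ^ 2 - 1)) (piGaussian ι) θ
      = ∏ i, mgf (fun x : ι → ℝ => x i ^ 2 - 1) (piGaussian ι) θ := by
        rw [← iIndepFun_sq_sub_one_piGaussian.mgf_sum fun i => by fun_prop]
        congr 1
        ext x
        rw [Finset.sum_apply]
    _ ≤ ∏ _i : ι, Real.exp (4 * θ ^ 2) := Finset.prod_le_prod (fun _ _ => mgf_nonneg)
        fun i _ => hcoord i
    _ = Real.exp (4 * Fintype.card ι * θ ^ 2) := by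
        rw [Finset.prod_const, Finset.card_univ, ← Real.exp_nat_mul]
        ring_nf

lemma measureReal_le_sum_sq_sub_one_le {θ : ℝ} (hθ : 0 ≤ θ) (hθ' : θ ≤ 1 / 4) (a : ℝ) :
    (piGaussian ι).real {x | a ≤ ∑ i, (x i ^ 2 - 1)} ≤
      Real.exp (4 * Fintype.card ι * θ ^ 2 - θ * a) := by
  refine (measure_ge_le_exp_mul_mgf a hθ
    (integrable_exp_mul_sum_sq_sub_one (by linarith))).trans ?_
  rw [sub_eq_neg_add, Real.exp_add, ← neg_mul]
  gcongr
  exact mgf_sum_sq_sub_one_le (abs_le.2 ⟨by linarith, hθ'⟩)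

lemma measureReal_sum_sq_sub_one_le_neg_le {θ : ℝ} (hθ : 0 ≤ θ) (hθ' : θ ≤ 1 / 4) (a : ℝ) :
    (piGaussian ι).real {x | ∑ i, (x i ^ 2 - 1) ≤ -a} ≤
      Real.exp (4 * Fintype.card ι * θ ^ 2 - θ * a) := by
  refine (measure_le_le_exp_mul_mgf (-a) (neg_nonpos.2 hθ)
    (integrable_exp_mul_sum_sq_sub_one (by linarith))).trans ?_
  rw [sub_eq_neg_add, Real.exp_add, neg_neg, mul_neg, ← neg_sq θ]
  gcongr
  exact mgf_sum_sq_sub_one_le (abs_le.2 ⟨by linarith, by linarith⟩)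

end GaussianMoments

section Converse

lemma integral_le_log_card {Ω M : Type*} [MeasurableSpace Ω] {μ : Measure Ω}
    [IsProbabilityMeasure μ] [Fintype M] {U : M → Ω → ℝ}
    (hU : ∀ m, Integrable (fun ω => Real.exp (U m ω)) μ)
    (hU_le : ∀ m, ∫ ω, Real.exp (U m ω) ∂μ ≤ 1) (enc : Ω → M)
    (hint : Integrable (fun ω => U (enc ω) ω) μ) :
    ∫ ω, U (enc ω) ω ∂μ ≤ Real.log (Fintype.card M) := by
  have hsum : Integrable (fun ω => ∑ m, Real.exp (U m ω)) μ :=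
    integrable_finsetSum _ fun m _ => hU m
  have hle (ω : Ω) : Real.exp (U (enc ω) ω) ≤ ∑ m, Real.exp (U m ω) :=
    Finset.single_le_sum (f := fun m => Real.exp (U m ω)) (fun _ _ => (Real.exp_pos _).le)
      (Finset.mem_univ (enc ω))
  have hexp : Integrable (fun ω => Real.exp (U (enc ω) ω)) μ :=
    hsum.mono' (Real.continuous_exp.comp_aestronglyMeasurable hint.1) <| ae_of_all _ fun ω => by
      rw [Real.norm_of_nonneg (Real.exp_pos _).le]
      exact hle ω
  have hjensen : Real.exp (∫ ω, U (enc ω) ω ∂μ) ≤ ∫ ω, Real.exp (U (enc ω) ω) ∂μ :=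
    convexOn_exp.map_integral_le Real.continuous_exp.continuousOn isClosed_univ
      (ae_of_all _ fun _ => Set.mem_univ _) hint hexp
  have hunion : ∫ ω, Real.exp (U (enc ω) ω) ∂μ ≤ Fintype.card M := calc
    _ ≤ ∫ ω, ∑ m, Real.exp (U m ω) ∂μ := integral_mono hexp hsum hle
    _ = ∑ m, ∫ ω, Real.exp (U m ω) ∂μ := integral_finsetSum _ fun m _ => hU m
    _ ≤ ∑ _m : M, (1 : ℝ) := Finset.sum_le_sum fun m _ => hU_le m
    _ = Fintype.card M := by simp
  rw [← Real.log_exp (∫ ω, U (enc ω) ω ∂μ)]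
  exact Real.log_le_log (Real.exp_pos _) (hjensen.trans hunion)

/-- The exponential tilt certifying the waterfilling bound in a coordinate with ratio `r = l / t` of
weight to water level, source value `x` and reproduction `y`. For `1 ≤ r` it is the information
density of the Gaussian test channel with noise variance `r⁻¹`. -/
noncomputable def waterTilt (r x y : ℝ) : ℝ :=
  (max 0 (Real.log r) + min 1 r * x ^ 2 - r * (x - y) ^ 2) / 2

lemma waterTilt_of_one_le {r : ℝ} (hr : 1 ≤ r) (x y : ℝ) :
    waterTilt r x y = gaussianInfoDensity y r.toNNReal⁻¹ x := by
  rw [waterTilt, gaussianInfoDensity, NNReal.coe_inv, Real.coe_toNNReal _ (zero_le_one.trans hr),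
    max_eq_right (Real.log_nonneg hr), min_eq_left hr, Real.log_inv, div_inv_eq_mul]
  ring

lemma waterTilt_of_le_one {r : ℝ} (hr : 0 ≤ r) (hr' : r ≤ 1) (x y : ℝ) :
    waterTilt r x y = r * y * x - r * y ^ 2 / 2 := by
  rw [waterTilt, max_eq_left (Real.log_nonpos hr hr'), min_eq_right hr']
  ring

lemma integrable_exp_waterTilt {r : ℝ} (hr : 0 ≤ r) (y : ℝ) :
    Integrable (fun x => Real.exp (waterTilt r x y)) (gaussianReal 0 1) := by
  rcases le_total 1 r with h1 | h1
  · simp only [waterTilt_of_one_le h1]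
    exact integrable_exp_gaussianInfoDensity y
      (inv_ne_zero (Real.toNNReal_pos.2 (one_pos.trans_le h1)).ne')
  · simp only [waterTilt_of_le_one hr h1, Real.exp_sub]
    exact (integrable_exp_mul_gaussianReal _).div_const _

lemma integral_exp_waterTilt_le_one {r : ℝ} (hr : 0 ≤ r) (y : ℝ) :
    ∫ x, Real.exp (waterTilt r x y) ∂gaussianReal 0 1 ≤ 1 := by
  rcases le_total 1 r with h1 | h1
  · simp only [waterTilt_of_one_le h1]
    exact (integral_exp_gaussianInfoDensity y
      (inv_ne_zero (Real.toNNReal_pos.2 (one_pos.trans_le h1)).ne')).le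
  · have hmgf : ∫ x, Real.exp (r * y * x) ∂gaussianReal 0 1 = Real.exp ((r * y) ^ 2 / 2) := by
      simpa [mgf] using congrFun (mgf_fun_id_gaussianReal (μ := 0) (v := 1)) (r * y)
    simp only [waterTilt_of_le_one hr h1, Real.exp_sub]
    rw [integral_div, hmgf, ← Real.exp_sub, Real.exp_le_one_iff]
    nlinarith [mul_nonneg (mul_nonneg hr (sub_nonneg.2 h1)) (sq_nonneg y)]

variable {ι : Type*} [Fintype ι]

lemma integrable_exp_sum_waterTilt {r : ι → ℝ} (hr : ∀ i, 0 ≤ r i) (y : ι → ℝ) :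
    Integrable (fun x => Real.exp (∑ i, waterTilt (r i) (x i) (y i))) (piGaussian ι) := by
  simp only [Real.exp_sum]
  exact Integrable.fintype_prod (f := fun i x => Real.exp (waterTilt (r i) x (y i)))
    fun i => integrable_exp_waterTilt (hr i) (y i)

lemma integral_exp_sum_waterTilt_le_one {r : ι → ℝ} (hr : ∀ i, 0 ≤ r i) (y : ι → ℝ) :
    ∫ x, Real.exp (∑ i, waterTilt (r i) (x i) (y i)) ∂piGaussian ι ≤ 1 := by
  simp only [Real.exp_sum]
  rw [integral_fintype_prod_eq_prod fun i x => Real.exp (waterTilt (r i) x (y i))]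
  exact Finset.prod_le_one (fun i _ => integral_nonneg fun x => (Real.exp_pos _).le)
    fun i _ => integral_exp_waterTilt_le_one (hr i) (y i)

lemma sum_waterTilt (l : ι → ℝ) {t : ℝ} (ht : 0 < t) (x y : ι → ℝ) :
    ∑ i, waterTilt (l i / t) (x i) (y i) =
      waterNats l t + (∑ i, min (l i) t * x i ^ 2 - weightedSqDist l x y) / (2 * t) := by
  rw [waterNats, weightedSqDist, ← Finset.sum_sub_distrib, Finset.sum_div,
    ← Finset.sum_add_distrib]
  refine Finset.sum_congr rfl fun i _ => ?_
  have hmin : min 1 (l i / t) = min (l i) t / t := by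
    rw [min_comm, ← min_div_div_right ht.le, div_self ht.ne']
  rw [waterTilt, hmin]
  field_simp
  ring

lemma integrable_sum_mul_sq (c : ι → ℝ) :
    Integrable (fun x => ∑ i, c i * x i ^ 2) (piGaussian ι) :=
  integrable_finsetSum _ fun i _ => (integrable_eval_pow_piGaussian 2 i).const_mul (c i)

lemma integral_sum_mul_sq (c : ι → ℝ) :
    ∫ x, ∑ i, c i * x i ^ 2 ∂piGaussian ι = ∑ i, c i := by
  rw [integral_finsetSum _ fun i _ => (integrable_eval_pow_piGaussian 2 i).const_mul (c i)]
  refine Finset.sum_congr rfl fun i _ => ?_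
  rw [integral_const_mul, integral_eval_piGaussian (f := fun x => x ^ 2) (by fun_prop),
    integral_sq_gaussianReal, mul_one]

lemma sum_min_le_integral_weightedSqDist {M : Type*} [Fintype M] {l : ι → ℝ} (hl : ∀ i, 0 ≤ l i)
    {t : ℝ} (ht : 0 < t) (enc : (ι → ℝ) → M) (dec : M → ι → ℝ)
    (hint : Integrable (fun x => weightedSqDist l x (dec (enc x))) (piGaussian ι)) :
    ∑ i, min (l i) t ≤ ∫ x, weightedSqDist l x (dec (enc x)) ∂piGaussian ι +
      2 * t * (Real.log (Fintype.card M) - waterNats l t) := by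
  have hr (i : ι) : 0 ≤ l i / t := div_nonneg (hl i) ht.le
  have hgap : Integrable (fun x =>
      ∑ i, min (l i) t * x i ^ 2 - weightedSqDist l x (dec (enc x))) (piGaussian ι) :=
    (integrable_sum_mul_sq _).sub hint
  have hmean : ∫ x, ∑ i, waterTilt (l i / t) (x i) (dec (enc x) i) ∂piGaussian ι =
      waterNats l t + (∑ i, min (l i) t -
        ∫ x, weightedSqDist l x (dec (enc x)) ∂piGaussian ι) / (2 * t) := by
    simp only [sum_waterTilt l ht]
    rw [integral_add (integrable_const _) (hgap.div_const _), integral_div,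
      integral_sub (integrable_sum_mul_sq _) hint, integral_sum_mul_sq]
    simp
  have hlog := integral_le_log_card (integrable_exp_sum_waterTilt hr <| dec ·)
    (integral_exp_sum_waterTilt_le_one hr <| dec ·) enc <| by
      simp only [sum_waterTilt l ht]
      exact (integrable_const _).add (hgap.div_const _)
  rw [hmean, ← le_sub_iff_add_le', div_le_iff₀' (by positivity)] at hlog
  linarith

variable {n : ℕ} {R : ℝ} {S : Matrix (Fin n) (Fin n) ℝ}

lemma wfDistAt_le_expDist (hS : S.PosSemidef) {t : ℝ} (ht : 0 < t)
    (q : QuantScheme n (wfRateAt hS t)) : n * wfDistAt hS t ≤ q.expDist S := by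
  set e := eigenCoord hS.isHermitian
  have hint : Integrable (fun x => weightedSqDist hS.isHermitian.eigenvalues x
      (e (q.dec (q.enc (e.symm x))))) (piGaussian (Fin n)) := by
    rw [← (measurePreserving_eigenCoord hS.isHermitian).integrable_comp_emb
      e.measurableEmbedding]
    simpa only [Function.comp_def, e, MeasurableEquiv.symm_apply_apply,
      quadDist_eq_weightedSqDist hS.isHermitian] using integrable_quadDist_scheme hS q
  have hconverse := sum_min_le_integral_weightedSqDist hS.eigenvalues_nonneg ht
    (fun x => q.enc (e.symm x)) (fun m => e (q.dec m)) hint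
  have hrate : Real.log (Fintype.card (Fin ⌊(2 : ℝ) ^ (n * wfRateAt hS t)⌋₊)) ≤
      waterNats hS.isHermitian.eigenvalues t := by
    rw [Fintype.card_fin, ← mul_wfRateAt_mul_log_two hS, ← Real.log_rpow two_pos]
    exact Real.log_le_log (by exact_mod_cast (q.enc 0).pos) (Nat.floor_le (by positivity))
  rw [mul_wfDistAt, QuantScheme.expDist,
    integral_quadDist_eq_integral_weightedSqDist hS.isHermitian fun w => q.dec (q.enc w)]
  nlinarith

lemma QuantScheme.rate_nonneg (q : QuantScheme n R) (hn : 0 < n) : 0 ≤ R := by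
  by_contra! hR
  have hempty : ⌊(2 : ℝ) ^ ((n : ℝ) * R)⌋₊ = 0 :=
    Nat.floor_eq_zero.2 (Real.rpow_lt_one_of_one_lt_of_neg one_lt_two
      (mul_neg_of_pos_of_neg (by exact_mod_cast hn) hR))
  exact (q.enc 0).pos.ne' hempty

lemma wfDist_of_not_exists (hS : S.PosSemidef) (h : ¬∃ t, 0 < t ∧ wfRateAt hS t = R) :
    wfDist R hS = S.trace / n :=
  dif_neg h

lemma wfDist_le_expDist (hn : 0 < n) (hS : S.PosSemidef) (q : QuantScheme n R) :
    n * wfDist R hS ≤ q.expDist S := by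
  by_cases hlevel : ∃ t, 0 < t ∧ wfRateAt hS t = R
  · obtain ⟨t, ht, rfl⟩ := hlevel
    rw [wfDist_eq hS ht rfl]
    exact wfDistAt_le_expDist hS ht q
  · have hS0 : S = 0 := by
      by_contra hS0
      exact hlevel (exists_wfRateAt_eq hS hS0 (q.rate_nonneg hn))
    rw [wfDist_of_not_exists hS hlevel, hS0, Matrix.trace_zero, zero_div, mul_zero, ← hS0]
    exact integral_nonneg fun w => quadDist_nonneg hS _ _

end Converse

section Covering

variable {Ω Y : Type*} [MeasurableSpace Ω] {μ : Measure Ω} [IsProbabilityMeasure μ]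

lemma exists_finset_greedy_cover {A : Y → Set Ω} (hA : ∀ y, MeasurableSet (A y)) {δ η : ℝ}
    (hδ : δ ≤ 1) (hη : 0 ≤ η)
    (hstep : ∀ F, MeasurableSet F → ∃ y, δ * (μ.real F - η) ≤ μ.real (F ∩ A y)) (m : ℕ) :
    ∃ C : Finset Y, C.card ≤ m ∧ μ.real {ω | ∀ y ∈ C, ω ∉ A y} ≤ η + (1 - δ) ^ m := by
  classical
  induction m with
  | zero => exact ⟨∅, le_rfl, by simpa⟩
  | succ m ih =>
    obtain ⟨C, hcard, hC⟩ := ih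
    set F : Set Ω := {ω | ∀ y ∈ C, ω ∉ A y}
    have hF : MeasurableSet F := by
      have hF_eq : F = ⋂ y ∈ C, (A y)ᶜ := by ext; simp [F]
      exact hF_eq ▸ C.measurableSet_biInter fun y _ => (hA y).compl
    obtain ⟨y, hy⟩ := hstep F hF
    refine ⟨insert y C, (Finset.card_insert_le y C).trans (by lia), ?_⟩
    have hrest : {ω | ∀ z ∈ insert y C, ω ∉ A z} = F \ A y := by
      ext ω
      simp [F, and_comm]
    have hsplit := measureReal_inter_add_sdiff (μ := μ) (s := F) (hA y)
    have hshrink := mul_le_mul_of_nonneg_left hC (sub_nonneg.2 hδ)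
    rw [hrest, pow_succ']
    linarith

variable [MeasurableSpace Y] {ν : Measure Y} [IsProbabilityMeasure ν] {π : Measure (Y × Ω)}
  [IsFiniteMeasure π]

lemma exists_le_measureReal_inter_of_restrict_le (hπ : MeasurePreserving Prod.snd π μ)
    {A : Set (Y × Ω)} (hA : MeasurableSet A) {K : ℝ} (hK : 0 < K)
    (hdens : π.restrict A ≤ ENNReal.ofReal K • ν.prod μ) {F : Set Ω} (hF : MeasurableSet F) :
    ∃ y, K⁻¹ * (μ.real F - π.real Aᶜ) ≤ μ.real (F ∩ Prod.mk y ⁻¹' A) := by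
  have hE : MeasurableSet (Prod.snd ⁻¹' F ∩ A) := (measurable_snd hF).inter hA
  obtain ⟨y, hy⟩ := exists_lintegral_le (μ := ν)
    (f := fun y => μ (Prod.mk y ⁻¹' (Prod.snd ⁻¹' F ∩ A)))
    (by rw [← Measure.prod_apply hE]; exact measure_ne_top _ _)
  rw [← Measure.prod_apply hE] at hy
  have hcapture : π.real (Prod.snd ⁻¹' F ∩ A) ≤ K * μ.real (F ∩ Prod.mk y ⁻¹' A) := by
    have hENN : π (Prod.snd ⁻¹' F ∩ A) ≤ ENNReal.ofReal K * μ (F ∩ Prod.mk y ⁻¹' A) := calc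
      _ = π.restrict A (Prod.snd ⁻¹' F ∩ A) :=
        (Measure.restrict_eq_self π Set.inter_subset_right).symm
      _ ≤ ENNReal.ofReal K * ν.prod μ (Prod.snd ⁻¹' F ∩ A) := hdens _
      _ ≤ ENNReal.ofReal K * μ (F ∩ Prod.mk y ⁻¹' A) := mul_le_mul_right hy _
    have hreal := ENNReal.toReal_mono (by finiteness) hENN
    rwa [ENNReal.toReal_mul, ENNReal.toReal_ofReal hK.le] at hreal
  have hsplit := measureReal_inter_add_sdiff (μ := π) (s := Prod.snd ⁻¹' F) hA
  have hmiss : π.real (Prod.snd ⁻¹' F \ A) ≤ π.real Aᶜ := measureReal_mono fun _ hp => hp.2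
  rw [hπ.measureReal_preimage hF.nullMeasurableSet] at hsplit
  refine ⟨y, ?_⟩
  rw [inv_mul_le_iff₀ hK]
  linarith

lemma exists_finset_cover_of_restrict_le (hπ : MeasurePreserving Prod.snd π μ)
    {A : Set (Y × Ω)} (hA : MeasurableSet A) {K : ℝ} (hK : 1 ≤ K)
    (hdens : π.restrict A ≤ ENNReal.ofReal K • ν.prod μ) (m : ℕ) :
    ∃ C : Finset Y, C.card ≤ m ∧
      μ.real {ω | ∀ y ∈ C, (y, ω) ∉ A} ≤ π.real Aᶜ + (1 - K⁻¹) ^ m :=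
  exists_finset_greedy_cover (A := fun y => Prod.mk y ⁻¹' A)
    (fun _ => measurable_prodMk_left hA) (inv_le_one_of_one_le₀ hK) measureReal_nonneg
    (fun _ => exists_le_measureReal_inter_of_restrict_le hπ hA (one_pos.trans_le hK) hdens) m

end Covering

section GaussianTestChannel

variable {ι : Type*} [Fintype ι]

/-- The joint law of input and output of the Gaussian test channel with noise variances `s`: the
input coordinates are centred Gaussian with variance `1 - s i`, so that for `s ≤ 1` the output is
standard Gaussian. -/
noncomputable def gaussianTestChannel (s : ι → ℝ≥0) : Measure ((ι → ℝ) × (ι → ℝ)) :=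
  ((Measure.pi fun i => gaussianReal 0 (1 - s i)).prod (piGaussian ι)).map
    fun p => (p.1, fun i => p.1 i + √(s i) * p.2 i)

instance (s : ι → ℝ≥0) : IsProbabilityMeasure (gaussianTestChannel s) :=
  Measure.isProbabilityMeasure_map (by fun_prop)

lemma measurePreserving_const_add_sqrt_mul (y : ℝ) (s : ℝ≥0) :
    MeasurePreserving (fun z => y + √s * z) (gaussianReal 0 1) (gaussianReal y s) := by
  refine ⟨by fun_prop, ?_⟩
  have hcomp : (fun z : ℝ => y + √s * z) = (fun z => y + z) ∘ fun z => √(s : ℝ) * z := rfl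
  have hvar : NNReal.mk (√s ^ 2) (sq_nonneg _) * 1 = s := by
    ext
    simp
  rw [hcomp, ← Measure.map_map (by fun_prop) (by fun_prop), gaussianReal_map_const_mul,
    gaussianReal_map_const_add, hvar, mul_zero, zero_add]

lemma measurePreserving_snd_gaussianTestChannel {s : ι → ℝ≥0} (hs : ∀ i, s i ≤ 1) :
    MeasurePreserving Prod.snd (gaussianTestChannel s) (piGaussian ι) := by
  have hcoord (i : ι) : MeasurePreserving (fun p : ℝ × ℝ => p.1 + √(s i) * p.2)
      ((gaussianReal 0 (1 - s i)).prod (gaussianReal 0 1)) (gaussianReal 0 1) := by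
    have hadd : MeasurePreserving (fun p : ℝ × ℝ => p.1 + p.2)
        ((gaussianReal 0 (1 - s i)).prod (gaussianReal 0 (s i))) (gaussianReal 0 1) := by
      refine ⟨by fun_prop, ?_⟩
      have hconv := gaussianReal_conv_gaussianReal (m₁ := 0) (m₂ := 0) (v₁ := 1 - s i) (v₂ := s i)
      rwa [tsub_add_cancel_of_le (hs i), add_zero] at hconv
    have hnoise := measurePreserving_const_add_sqrt_mul 0 (s i)
    simp only [zero_add] at hnoise
    exact hadd.comp ((MeasurePreserving.id _).prod hnoise)
  have hout : MeasurePreserving (fun p : (ι → ℝ) × (ι → ℝ) => fun i => p.1 i + √(s i) * p.2 i)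
      ((Measure.pi fun i => gaussianReal 0 (1 - s i)).prod (piGaussian ι)) (piGaussian ι) :=
    (measurePreserving_pi _ _ hcoord).comp (measurePreserving_arrowProdEquivProdArrow ℝ ℝ ι
      (fun i => gaussianReal 0 (1 - s i)) (fun _ => gaussianReal 0 1)).symm
  refine ⟨measurable_snd, ?_⟩
  rw [gaussianTestChannel, Measure.map_map measurable_snd (by fun_prop)]
  exact hout.map_eq

lemma measurePreserving_noise_gaussianTestChannel {s : ι → ℝ≥0} (hs : ∀ i, s i ≠ 0) :
    MeasurePreserving (fun p i => (p.2 i - p.1 i) / √(s i)) (gaussianTestChannel s)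
      (piGaussian ι) := by
  have hnoise : (fun p : (ι → ℝ) × (ι → ℝ) => fun i => (p.2 i - p.1 i) / √(s i)) ∘
      (fun p => (p.1, fun i => p.1 i + √(s i) * p.2 i)) = Prod.snd := by
    ext p i
    have hsqrt : √(s i : ℝ) ≠ 0 := Real.sqrt_ne_zero'.2 (NNReal.coe_pos.2 (hs i).pos)
    simp only [Function.comp_apply, add_sub_cancel_left]
    rw [mul_div_cancel_left₀ _ hsqrt]
  refine ⟨by fun_prop, ?_⟩
  rw [gaussianTestChannel, Measure.map_map (by fun_prop) (by fun_prop), hnoise]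
  exact measurePreserving_snd.map_eq

lemma gaussianTestChannel_eq_withDensity {s : ι → ℝ≥0} (hs : ∀ i, s i ≠ 0) :
    gaussianTestChannel s =
      ((Measure.pi fun i => gaussianReal 0 (1 - s i)).prod (piGaussian ι)).withDensity fun p =>
        ENNReal.ofReal (Real.exp (∑ i, gaussianInfoDensity (p.1 i) (s i) (p.2 i))) := by
  have hmap : Measurable fun p : (ι → ℝ) × (ι → ℝ) =>
      (p.1, fun i => p.1 i + √(s i) * p.2 i) := by fun_prop
  ext E hE
  rw [gaussianTestChannel, Measure.map_apply hmap hE, Measure.prod_apply (hmap hE),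
    withDensity_apply _ hE, ← lintegral_indicator hE,
    lintegral_prod _ (Measurable.indicator (by fun_prop) hE).aemeasurable]
  refine lintegral_congr fun y => ?_
  have hEy : MeasurableSet (Prod.mk y ⁻¹' E) := measurable_prodMk_left hE
  have hout := measurePreserving_pi (fun _ : ι => gaussianReal 0 1)
    (fun i => gaussianReal (y i) (s i)) fun i => measurePreserving_const_add_sqrt_mul (y i) (s i)
  calc piGaussian ι ((fun z i => y i + √(s i) * z i) ⁻¹' (Prod.mk y ⁻¹' E))
      = Measure.pi (fun i => gaussianReal (y i) (s i)) (Prod.mk y ⁻¹' E) :=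
        hout.measure_preimage hEy.nullMeasurableSet
    _ = ∫⁻ w, (Prod.mk y ⁻¹' E).indicator (fun w => ENNReal.ofReal (Real.exp
          (∑ i, gaussianInfoDensity (y i) (s i) (w i)))) w ∂piGaussian ι := by
        rw [pi_gaussianReal_eq_withDensity y hs, withDensity_apply _ hEy, lintegral_indicator hEy]

lemma withDensity_restrict_le_smul {α : Type*} [MeasurableSpace α] {μ : Measure α}
    {f : α → ℝ≥0∞} {c : ℝ≥0∞} {A : Set α} (hA : MeasurableSet A) (hf : ∀ x ∈ A, f x ≤ c) :
    (μ.withDensity f).restrict A ≤ c • μ := calc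
  (μ.withDensity f).restrict A = (μ.restrict A).withDensity f := restrict_withDensity hA f
  _ ≤ (μ.restrict A).withDensity fun _ => c :=
    withDensity_mono ((ae_restrict_iff' hA).2 (ae_of_all _ hf))
  _ = c • μ.restrict A := withDensity_const c
  _ ≤ c • μ := by
    gcongr
    exact Measure.restrict_le_self

/-- The pairs of a codeword `p.1` and a source word `p.2` whose squared norm `∑ p.2 i ^ 2` and noise
energy `∑ (p.2 i - p.1 i) ^ 2 / s i` are typical for the Gaussian test channel, up to `a`. -/
def gaussianTypicalSet (s : ι → ℝ≥0) (a : ℝ) : Set ((ι → ℝ) × (ι → ℝ)) :=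
  {p | |∑ i, ((p.2 i - p.1 i) ^ 2 / s i - 1)| ≤ a ∧ ∑ i, (p.2 i ^ 2 - 1) ≤ a}

lemma measurableSet_gaussianTypicalSet (s : ι → ℝ≥0) (a : ℝ) :
    MeasurableSet (gaussianTypicalSet s a) := by
  have hnoise : Measurable fun p : (ι → ℝ) × (ι → ℝ) => |∑ i, ((p.2 i - p.1 i) ^ 2 / s i - 1)| :=
    Measurable.abs (by fun_prop)
  have hnorm : Measurable fun p : (ι → ℝ) × (ι → ℝ) => ∑ i, (p.2 i ^ 2 - 1) := by fun_prop
  exact (measurableSet_le hnoise measurable_const).inter (measurableSet_le hnorm measurable_const)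

lemma sum_gaussianInfoDensity_le {s : ι → ℝ≥0} {a : ℝ} {p : (ι → ℝ) × (ι → ℝ)}
    (hp : p ∈ gaussianTypicalSet s a) :
    ∑ i, gaussianInfoDensity (p.1 i) (s i) (p.2 i) ≤ ∑ i, -Real.log (s i) / 2 + a := by
  obtain ⟨hnoise, hnorm⟩ := hp
  have hsplit : ∑ i, gaussianInfoDensity (p.1 i) (s i) (p.2 i) = ∑ i, -Real.log (s i) / 2 +
      (∑ i, (p.2 i ^ 2 - 1) - ∑ i, ((p.2 i - p.1 i) ^ 2 / s i - 1)) / 2 := by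
    rw [← Finset.sum_sub_distrib, Finset.sum_div, ← Finset.sum_add_distrib]
    refine Finset.sum_congr rfl fun i _ => ?_
    rw [gaussianInfoDensity]
    ring
  linarith [(abs_le.1 hnoise).1]

lemma measureReal_compl_gaussianTypicalSet_le {s : ι → ℝ≥0} (hs0 : ∀ i, s i ≠ 0)
    (hs1 : ∀ i, s i ≤ 1) {θ : ℝ} (hθ : 0 ≤ θ) (hθ' : θ ≤ 1 / 4) (a : ℝ) :
    (gaussianTestChannel s).real (gaussianTypicalSet s a)ᶜ ≤
      3 * Real.exp (4 * Fintype.card ι * θ ^ 2 - θ * a) := by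
  set noise : (ι → ℝ) × (ι → ℝ) → ι → ℝ := fun p i => (p.2 i - p.1 i) / √(s i)
  have hnoise_sq (p : (ι → ℝ) × (ι → ℝ)) :
      ∑ i, ((p.2 i - p.1 i) ^ 2 / s i - 1) = ∑ i, (noise p i ^ 2 - 1) := by
    simp only [noise, div_pow, Real.sq_sqrt (NNReal.coe_nonneg _)]
  set upper : Set (ι → ℝ) := {x | a ≤ ∑ i, (x i ^ 2 - 1)}
  set lower : Set (ι → ℝ) := {x | ∑ i, (x i ^ 2 - 1) ≤ -a}
  have hupper : MeasurableSet upper := measurableSet_le measurable_const (by fun_prop)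
  have hlower : MeasurableSet lower := measurableSet_le (by fun_prop) measurable_const
  have hsub : (gaussianTypicalSet s a)ᶜ ⊆ (noise ⁻¹' upper ∪ noise ⁻¹' lower) ∪
      Prod.snd ⁻¹' upper := by
    intro p hp
    by_contra hcon
    simp only [Set.mem_union, Set.mem_preimage, upper, lower, Set.mem_ofPred_eq, not_or,
      not_le] at hcon
    refine hp ⟨?_, hcon.2.le⟩
    rw [hnoise_sq, abs_le]
    exact ⟨hcon.1.2.le, hcon.1.1.le⟩
  have hnoise := measurePreserving_noise_gaussianTestChannel hs0
  have hsnd := measurePreserving_snd_gaussianTestChannel hs1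
  calc (gaussianTestChannel s).real (gaussianTypicalSet s a)ᶜ
      ≤ (gaussianTestChannel s).real (noise ⁻¹' upper) +
          (gaussianTestChannel s).real (noise ⁻¹' lower) +
          (gaussianTestChannel s).real (Prod.snd ⁻¹' upper) :=
        (measureReal_mono hsub).trans <| (measureReal_union_le _ _).trans <| by
          gcongr
          exact measureReal_union_le _ _
    _ = (piGaussian ι).real upper + (piGaussian ι).real lower + (piGaussian ι).real upper := by
        rw [hnoise.measureReal_preimage hupper.nullMeasurableSet,
          hnoise.measureReal_preimage hlower.nullMeasurableSet,
          hsnd.measureReal_preimage hupper.nullMeasurableSet]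
    _ ≤ 3 * Real.exp (4 * Fintype.card ι * θ ^ 2 - θ * a) := by
        linarith [measureReal_le_sum_sq_sub_one_le (ι := ι) hθ hθ' a,
          measureReal_sum_sq_sub_one_le_neg_le (ι := ι) hθ hθ' a]

lemma exists_finset_gaussian_cover {s : ι → ℝ≥0} (hs0 : ∀ i, s i ≠ 0) (hs1 : ∀ i, s i ≤ 1)
    {a r θ : ℝ} (ha : 0 ≤ a) (hr : ∑ i, -Real.log (s i) / 2 ≤ r) (hθ : 0 ≤ θ) (hθ' : θ ≤ 1 / 4)
    (m : ℕ) :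
    ∃ C : Finset (ι → ℝ), C.card ≤ m ∧
      (piGaussian ι).real {w | ∀ y ∈ C, Fintype.card ι + a < ∑ i, (w i - y i) ^ 2 / s i} ≤
        3 * Real.exp (4 * Fintype.card ι * θ ^ 2 - θ * a) + (1 - (Real.exp (r + a))⁻¹) ^ m := by
  have hA := measurableSet_gaussianTypicalSet s a
  have hr0 : 0 ≤ r := le_trans (Finset.sum_nonneg fun i _ => by
    linarith [Real.log_nonpos (s i).coe_nonneg (NNReal.coe_le_one.2 (hs1 i))]) hr
  obtain ⟨C, hcard, hC⟩ := exists_finset_cover_of_restrict_le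
    (measurePreserving_snd_gaussianTestChannel hs1) hA (Real.one_le_exp (add_nonneg hr0 ha))
    (by
      rw [gaussianTestChannel_eq_withDensity hs0]
      exact withDensity_restrict_le_smul hA fun p hp =>
        ENNReal.ofReal_le_ofReal
          (Real.exp_le_exp.2 ((sum_gaussianInfoDensity_le hp).trans (by gcongr)))) m
  refine ⟨C, hcard, (measureReal_mono fun w hw y hy hmem => ?_).trans <|
    hC.trans <| add_le_add_left (measureReal_compl_gaussianTypicalSet_le hs0 hs1 hθ hθ' a) _⟩
  have hnoise := (abs_le.1 hmem.1).2
  simp only [Finset.sum_sub_distrib, Finset.sum_const, Finset.card_univ, nsmul_eq_mul,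
    mul_one] at hnoise
  linarith [hw y hy]

end GaussianTestChannel

section Codebook

variable {ι : Type*} [Fintype ι]

lemma mul_log_one_add_div_le {k a : ℝ} (hk : 0 ≤ k) (ha : 0 ≤ a) :
    k * Real.log (1 + a / k) ≤ a := by
  rcases hk.eq_or_lt with rfl | hk
  · simpa using ha
  calc k * Real.log (1 + a / k) ≤ k * (a / k) := by
        gcongr
        linarith [Real.log_le_sub_one_of_pos (x := 1 + a / k) (by positivity)]
    _ = a := mul_div_cancel₀ a hk.ne'

lemma exists_noise_variances {l : ι → ℝ} {t : ℝ} (ht : 0 < t) (hl : ∀ i, t ≤ l i) {a : ℝ}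
    (ha : 0 ≤ a) :
    ∃ s : ι → ℝ≥0, (∀ i, s i ≠ 0) ∧ (∀ i, s i ≤ 1) ∧
      ∑ i, -Real.log (s i) / 2 ≤ waterNats l t + a / 2 ∧
      ∀ w y : ι → ℝ, ∑ i, (w i - y i) ^ 2 / s i ≤ Fintype.card ι + a →
        weightedSqDist l w y ≤ Fintype.card ι * t := by
  -- Dividing the variances `t / l i` by `r` makes noise energy `card ι + a` produce distortion
  -- `card ι * t`.
  set r : ℝ := 1 + a / Fintype.card ι
  have hr : 1 ≤ r := le_add_of_nonneg_right (by positivity)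
  have hl0 (i : ι) : 0 < l i := ht.trans_le (hl i)
  have hrl (i : ι) : 0 < r * l i := mul_pos (by positivity) (hl0 i)
  have hs_coe (i : ι) : ((t / (r * l i)).toNNReal : ℝ) = t / (r * l i) :=
    Real.coe_toNNReal _ (div_pos ht (hrl i)).le
  refine ⟨fun i => (t / (r * l i)).toNNReal,
    fun i => (Real.toNNReal_pos.2 (div_pos ht (hrl i))).ne',
    fun i => Real.toNNReal_le_one.2 <| div_le_one_of_le₀
      ((hl i).trans (le_mul_of_one_le_left (hl0 i).le hr)) (hrl i).le, ?_, fun w y hnoise => ?_⟩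
  · have hcoord (i : ι) : -Real.log (t / (r * l i)) / 2 =
        max 0 (Real.log (l i / t)) / 2 + Real.log r / 2 := by
      rw [max_eq_right (Real.log_nonneg ((one_le_div ht).2 (hl i))),
        Real.log_div ht.ne' (hrl i).ne', Real.log_mul (by positivity) (hl0 i).ne',
        Real.log_div (hl0 i).ne' ht.ne']
      ring
    simp only [hs_coe, hcoord, Finset.sum_add_distrib, Finset.sum_const, Finset.card_univ,
      nsmul_eq_mul]
    rw [waterNats]
    linarith [mul_log_one_add_div_le (k := Fintype.card ι) (Nat.cast_nonneg _) ha]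
  · rcases isEmpty_or_nonempty ι with hι | hι
    · simp [weightedSqDist]
    have : (0 : ℝ) < Fintype.card ι := by exact_mod_cast Fintype.card_pos
    calc weightedSqDist l w y
        = t / r * ∑ i, (w i - y i) ^ 2 / (t / (r * l i)).toNNReal := by
          rw [weightedSqDist, Finset.mul_sum]
          refine Finset.sum_congr rfl fun i _ => ?_
          have := hrl i
          rw [hs_coe]
          field_simp
      _ ≤ t / r * (Fintype.card ι + a) := by gcongr
      _ = Fintype.card ι * t := by
          simp only [r]
          field_simp

lemma exists_finset_weightedSqDist_cover {l : ι → ℝ} {t : ℝ} (ht : 0 < t) (hl : ∀ i, t ≤ l i)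
    {a r θ : ℝ} (ha : 0 ≤ a) (hr : waterNats l t ≤ r) (hθ : 0 ≤ θ) (hθ' : θ ≤ 1 / 4) (m : ℕ) :
    ∃ C : Finset (ι → ℝ), C.card ≤ m ∧
      (piGaussian ι).real {w | ∀ y ∈ C, Fintype.card ι * t < weightedSqDist l w y} ≤
        3 * Real.exp (4 * Fintype.card ι * θ ^ 2 - θ * a) +
          (1 - (Real.exp (r + 3 * a / 2))⁻¹) ^ m := by
  obtain ⟨s, hs0, hs1, hrate, hdist⟩ := exists_noise_variances ht hl ha
  obtain ⟨C, hcard, hC⟩ := exists_finset_gaussian_cover hs0 hs1 ha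
    (hrate.trans (add_le_add_left hr (a / 2))) hθ hθ' m
  rw [show r + a / 2 + a = r + 3 * a / 2 by ring] at hC
  refine ⟨C, hcard, (measureReal_mono fun w hw y hy => ?_).trans hC⟩
  exact lt_of_not_ge fun hnoise => (hw y hy).not_ge (hdist w y hnoise)

/-- The distortion that waterfilling at level `t` aims for: `t` in every coordinate of weight
above `t`, and that of the reproduction `0` in the other coordinates. -/
noncomputable def floodedDist (l : ι → ℝ) (t : ℝ) (w : ι → ℝ) : ℝ :=
  ∑ i, if t < l i then t else l i * w i ^ 2

lemma weightedSqDist_extend_add (l : ι → ℝ) (t : ℝ) (w : ι → ℝ) (y : {i // t < l i} → ℝ) :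
    weightedSqDist l w (Function.extend Subtype.val y 0) + Fintype.card {i // t < l i} * t =
      weightedSqDist (fun i : {i // t < l i} => l i) (fun i => w i) y + floodedDist l t w := by
  have hactive (i : {i // t < l i}) : Function.extend Subtype.val y 0 i.1 = y i :=
    Subtype.val_injective.extend_apply y 0 i
  have hrest (i : {i // ¬t < l i}) : Function.extend Subtype.val y 0 i.1 = 0 :=
    Function.extend_apply' _ _ _ fun ⟨j, hj⟩ => i.2 (hj ▸ j.2)
  have hactive_term (i : {i // t < l i}) :
      (if t < l i then t else l i * w i ^ 2) = t := if_pos i.2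
  have hrest_term (i : {i // ¬t < l i}) :
      (if t < l i then t else l i * w i ^ 2) = l i * w i ^ 2 := if_neg i.2
  rw [weightedSqDist, floodedDist, weightedSqDist,
    ← Fintype.sum_subtype_add_sum_subtype (fun i => t < l i) fun i => l i * _ ^ 2,
    ← Fintype.sum_subtype_add_sum_subtype (fun i => t < l i) fun i => ite _ _ _]
  simp only [hactive, hrest, hactive_term, hrest_term, sub_zero, Finset.sum_const,
    Finset.card_univ, nsmul_eq_mul]
  ring

lemma waterNats_subtype_le (l : ι → ℝ) (t : ℝ) (p : ι → Prop) [DecidablePred p] :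
    waterNats (fun i : {i // p i} => l i) t ≤ waterNats l t := by
  have hsplit := Fintype.sum_subtype_add_sum_subtype p fun i => max 0 (Real.log (l i / t)) / 2
  have hrest := waterNats_nonneg (fun i : {i // ¬p i} => l i) t
  simp only [waterNats] at hrest ⊢
  linarith

lemma measurePreserving_subtype_restrict_piGaussian (p : ι → Prop) [DecidablePred p] :
    MeasurePreserving (fun (w : ι → ℝ) (i : {i // p i}) => w i) (piGaussian ι)
      (piGaussian {i // p i}) :=
  measurePreserving_fst.comp (measurePreserving_piEquivPiSubtypeProd (fun _ => gaussianReal 0 1) p)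

lemma exists_codebook (l : ι → ℝ) {t : ℝ} (ht : 0 < t) {a θ : ℝ} (ha : 0 ≤ a) (hθ : 0 ≤ θ)
    (hθ' : θ ≤ 1 / 4) (m : ℕ) :
    ∃ C : Finset (ι → ℝ), 0 ∈ C ∧ C.card ≤ m + 1 ∧
      (piGaussian ι).real {w | ∀ y ∈ C, floodedDist l t w < weightedSqDist l w y} ≤
        3 * Real.exp (4 * Fintype.card ι * θ ^ 2 - θ * a) +
          (1 - (Real.exp (waterNats l t + 3 * a / 2))⁻¹) ^ m := by
  classical
  obtain ⟨C, hcard, hC⟩ := exists_finset_weightedSqDist_cover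
    (l := fun i : {i // t < l i} => l i) ht (fun i => i.2.le) ha
    (waterNats_subtype_le l t fun i => t < l i) hθ hθ' m
  set extend : ({i // t < l i} → ℝ) → ι → ℝ := fun y => Function.extend Subtype.val y 0
  refine ⟨insert 0 (C.image extend), Finset.mem_insert_self _ _, (Finset.card_insert_le _ _).trans
    (by gcongr; exact Finset.card_image_le.trans hcard), ?_⟩
  have hsub : {w | ∀ y ∈ insert 0 (C.image extend), floodedDist l t w < weightedSqDist l w y} ⊆
      (fun w (i : {i // t < l i}) => w i) ⁻¹' {w | ∀ y ∈ C, Fintype.card {i // t < l i} * t <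
        weightedSqDist (fun i : {i // t < l i} => l i) w y} := fun w hw y hy => by
    have hfar := hw _ (Finset.mem_insert_of_mem (Finset.mem_image_of_mem extend hy))
    linarith [weightedSqDist_extend_add l t w y]
  have hrestrict := measurePreserving_subtype_restrict_piGaussian fun i => t < l i
  have hactive : Fintype.card {i // t < l i} ≤ Fintype.card ι := Fintype.card_subtype_le _
  calc _ ≤ (piGaussian ι).real (_ ⁻¹' _) := measureReal_mono hsub
    _ ≤ (piGaussian {i // t < l i}).real _ :=
      ENNReal.toReal_mono (measure_ne_top _ _)
        ((Measure.le_map_apply hrestrict.measurable.aemeasurable _).trans_eq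
          (by rw [hrestrict.map_eq]))
    _ ≤ _ := hC
    _ ≤ _ := by gcongr

end Codebook

section Scheme

lemma exists_measurable_forall_le {α ι : Type*} [MeasurableSpace α] [MeasurableSpace ι]
    [DiscreteMeasurableSpace ι] [Finite ι] [Nonempty ι] {f : ι → α → ℝ}
    (hf : ∀ i, Measurable (f i)) : ∃ e : α → ι, Measurable e ∧ ∀ x i, f (e x) x ≤ f i x := by
  classical
  suffices hfinset : ∀ s : Finset ι, s.Nonempty →
      ∃ e : α → ι, Measurable e ∧ ∀ x, ∀ i ∈ s, f (e x) x ≤ f i x by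
    have := Fintype.ofFinite ι
    obtain ⟨e, he, hmin⟩ := hfinset Finset.univ Finset.univ_nonempty
    exact ⟨e, he, fun x i => hmin x i (Finset.mem_univ i)⟩
  intro s hs
  induction hs using Finset.Nonempty.cons_induction with
  | singleton i => exact ⟨fun _ => i, measurable_const, by simp⟩
  | cons i s _ _ ih =>
    obtain ⟨e, he, hmin⟩ := ih
    have huncurry : Measurable fun p : ι × α => f p.1 p.2 := measurable_from_prod_countable_right hf
    have hvalue : Measurable fun x => f (e x) x := huncurry.comp (he.prodMk measurable_id)
    refine ⟨fun x => if f i x ≤ f (e x) x then i else e x,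
      Measurable.ite (measurableSet_le (hf i) hvalue) measurable_const he, fun x j hj => ?_⟩
    beta_reduce
    rcases Finset.mem_cons.1 hj with rfl | hj <;> split_ifs with hle
    · exact le_rfl
    · exact (not_le.1 hle).le
    · exact hle.trans (hmin x j hj)
    · exact hmin x j hj

variable {n : ℕ} {R : ℝ}

lemma measurable_quadDist (S : Matrix (Fin n) (Fin n) ℝ) (v : EuclideanSpace ℝ (Fin n)) :
    Measurable fun w => quadDist S w v := by
  simp only [quadDist, dotProduct, Matrix.mulVec]
  fun_prop

lemma exists_quantScheme_of_codebook (S : Matrix (Fin n) (Fin n) ℝ)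
    {C : Finset (EuclideanSpace ℝ (Fin n))} (hC : C.Nonempty)
    (hcard : C.card ≤ ⌊(2 : ℝ) ^ ((n : ℝ) * R)⌋₊) :
    ∃ q : QuantScheme n R, ∀ w, ∀ v ∈ C, quadDist S w (q.dec (q.enc w)) ≤ quadDist S w v := by
  have : NeZero ⌊(2 : ℝ) ^ ((n : ℝ) * R)⌋₊ := ⟨(hC.card_pos.trans_le hcard).ne'⟩
  obtain ⟨label⟩ : Nonempty (C ↪ Fin ⌊(2 : ℝ) ^ ((n : ℝ) * R)⌋₊) :=
    Function.Embedding.nonempty_of_card_le (by simpa using hcard)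
  set dec := Function.extend label Subtype.val 0
  obtain ⟨enc, henc, hmin⟩ := exists_measurable_forall_le fun j => measurable_quadDist S (dec j)
  refine ⟨⟨enc, dec, henc⟩, fun w v hv => (hmin w (label ⟨v, hv⟩)).trans_eq ?_⟩
  simp only [dec, label.injective.extend_apply]

variable {S : Matrix (Fin n) (Fin n) ℝ}

lemma integral_quadDist_zero_right (hS : S.IsHermitian) :
    ∫ w, quadDist S w 0 ∂stdGaussian (EuclideanSpace ℝ (Fin n)) = S.trace := by
  have hzero : eigenCoord hS 0 = 0 := by
    ext i
    rw [eigenCoord_apply, inner_zero_right, Pi.zero_apply]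
  rw [integral_quadDist_eq_integral_weightedSqDist hS fun _ => 0]
  simp only [hzero, weightedSqDist_zero_right]
  rw [integral_sum_mul_sq, trace_eq_sum_eigenvalues_real hS]

lemma exists_quantScheme_expDist_le_trace (hR : 0 ≤ R) (hS : S.PosSemidef) :
    ∃ q : QuantScheme n R, q.expDist S ≤ S.trace := by
  obtain ⟨q, hq⟩ := exists_quantScheme_of_codebook (R := R) S (Finset.singleton_nonempty 0)
    (Nat.le_floor (by simpa using Real.one_le_rpow one_le_two (by positivity : 0 ≤ n * R)))
  refine ⟨q, ?_⟩
  rw [← integral_quadDist_zero_right hS.isHermitian]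
  exact integral_mono (integrable_quadDist_scheme hS q) (integrable_quadDist S 0)
    fun w => hq w 0 (Finset.mem_singleton_self 0)

end Scheme

section Distortion

variable {ι : Type*} [Fintype ι]

lemma measurable_floodedDist (l : ι → ℝ) (t : ℝ) : Measurable (floodedDist l t) :=
  Finset.measurable_sum _ fun i _ => by split_ifs <;> fun_prop

lemma integrable_ite_mul_sq_piGaussian (l t : ℝ) (i : ι) :
    Integrable (fun w : ι → ℝ => if t < l then t else l * w i ^ 2) (piGaussian ι) := by
  split_ifs
  · exact integrable_const t
  · exact (integrable_eval_pow_piGaussian 2 i).const_mul l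

lemma integrable_floodedDist (l : ι → ℝ) (t : ℝ) :
    Integrable (floodedDist l t) (piGaussian ι) :=
  integrable_finsetSum _ fun i _ => integrable_ite_mul_sq_piGaussian (l i) t i

lemma integral_floodedDist (l : ι → ℝ) (t : ℝ) :
    ∫ w, floodedDist l t w ∂piGaussian ι = ∑ i, min (l i) t := by
  simp only [floodedDist]
  rw [integral_finsetSum _ fun i _ => integrable_ite_mul_sq_piGaussian (l i) t i]
  refine Finset.sum_congr rfl fun i _ => ?_
  split_ifs with hi
  · rw [integral_const, probReal_univ, one_smul, min_eq_right hi.le]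
  · rw [integral_const_mul, integral_eval_piGaussian (f := fun x => x ^ 2) (by fun_prop),
      integral_sq_gaussianReal, mul_one, min_eq_left (not_lt.1 hi)]

lemma setIntegral_eval_sq_piGaussian_le {F : Set (ι → ℝ)} (hF : MeasurableSet F) (i : ι) :
    ∫ w in F, w i ^ 2 ∂piGaussian ι ≤
      √((∫ x, x ^ 4 ∂gaussianReal 0 1) * (piGaussian ι).real F) := by
  have hsq : MemLp (fun w : ι → ℝ => w i ^ 2) (ENNReal.ofReal 2) (piGaussian ι) := by
    rw [ENNReal.ofReal_ofNat]
    refine (memLp_two_iff_integrable_sq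
      (integrable_eval_pow_piGaussian 2 i).aestronglyMeasurable).2 ?_
    simpa only [← pow_mul] using integrable_eval_pow_piGaussian (2 * 2) i
  have hfourth : ∫ w : ι → ℝ, (w i ^ 2) ^ 2 ∂piGaussian ι = ∫ x, x ^ 4 ∂gaussianReal 0 1 := by
    simp only [← pow_mul]
    exact integral_eval_piGaussian (f := fun x => x ^ 4) (by fun_prop) i
  have hind (w : ι → ℝ) : F.indicator (fun _ => (1 : ℝ)) w ^ 2 =
      F.indicator (fun _ => 1) w := by
    by_cases hw : w ∈ F <;> simp [hw]
  have hmul (w : ι → ℝ) : w i ^ 2 * F.indicator (fun _ => (1 : ℝ)) w =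
      F.indicator (fun w => w i ^ 2) w := by
    by_cases hw : w ∈ F <;> simp [hw]
  have hholder := integral_mul_le_Lp_mul_Lq_of_nonneg Real.HolderConjugate.two_two
    (ae_of_all _ fun w => sq_nonneg (w i))
    (ae_of_all _ (Set.indicator_nonneg fun _ _ => zero_le_one)) hsq
    (memLp_indicator_const _ hF (1 : ℝ) (Or.inr (measure_ne_top _ _)))
  simp only [Real.rpow_two, ← Real.sqrt_eq_rpow, hmul, hind, hfourth, integral_indicator hF,
    setIntegral_const, smul_eq_mul, mul_one] at hholder
  rwa [Real.sqrt_mul' _ measureReal_nonneg]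

lemma integral_le_sum_min_add {l : ι → ℝ} (hl : ∀ i, 0 ≤ l i) {t : ℝ} (ht : 0 ≤ t)
    {F : Set (ι → ℝ)} (hF : MeasurableSet F) {D : (ι → ℝ) → ℝ} (hD : ∀ w, 0 ≤ D w)
    (hDzero : ∀ w, D w ≤ ∑ i, l i * w i ^ 2) (hDflooded : ∀ w ∉ F, D w ≤ floodedDist l t w) :
    ∫ w, D w ∂piGaussian ι ≤ ∑ i, min (l i) t +
      √((∫ x, x ^ 4 ∂gaussianReal 0 1) * (piGaussian ι).real F) * ∑ i, l i := by
  have hflooded_nonneg (w : ι → ℝ) : 0 ≤ floodedDist l t w := Finset.sum_nonneg fun i _ => by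
    have := hl i
    split_ifs <;> positivity
  have hbad : Integrable (F.indicator fun w => ∑ i, l i * w i ^ 2) (piGaussian ι) :=
    (integrable_sum_mul_sq l).indicator hF
  calc ∫ w, D w ∂piGaussian ι
      ≤ ∫ w, (floodedDist l t w + F.indicator (fun w => ∑ i, l i * w i ^ 2) w) ∂piGaussian ι := by
        refine integral_mono_of_nonneg (ae_of_all _ hD) ((integrable_floodedDist l t).add hbad)
          (ae_of_all _ fun w => ?_)
        by_cases hw : w ∈ F
        · simpa [hw] using (hDzero w).trans (le_add_of_nonneg_left (hflooded_nonneg w))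
        · simpa [hw] using hDflooded w hw
    _ = ∑ i, min (l i) t + ∑ i, l i * ∫ w in F, w i ^ 2 ∂piGaussian ι := by
        rw [integral_add (integrable_floodedDist l t) hbad, integral_floodedDist,
          integral_indicator hF, integral_finsetSum _ fun i _ =>
            ((integrable_eval_pow_piGaussian 2 i).const_mul (l i)).integrableOn]
        simp only [integral_const_mul]
    _ ≤ ∑ i, min (l i) t + ∑ i, l i *
          √((∫ x, x ^ 4 ∂gaussianReal 0 1) * (piGaussian ι).real F) := by
        gcongr with i
        · exact hl i
        · exact setIntegral_eval_sq_piGaussian_le hF i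
    _ = _ := by rw [← Finset.sum_mul, mul_comm]

end Distortion

section Achievability

lemma one_sub_inv_pow_le_exp {K : ℝ} (hK : 1 ≤ K) (m : ℕ) :
    (1 - K⁻¹) ^ m ≤ Real.exp (-(m / K)) := calc
  (1 - K⁻¹) ^ m ≤ Real.exp (-K⁻¹) ^ m := by
    gcongr
    · exact sub_nonneg.2 (inv_le_one_of_one_le₀ hK)
    · exact Real.one_sub_le_exp_neg _
  _ = Real.exp (-(m / K)) := by
    rw [← Real.exp_nat_mul, div_eq_mul_inv, mul_neg]

variable {n : ℕ} {R t : ℝ} {S : Matrix (Fin n) (Fin n) ℝ}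

lemma exists_quantScheme_expDist_le_of_codebook (hS : S.PosSemidef) (ht : 0 ≤ t)
    {C : Finset (Fin n → ℝ)} (hC : 0 ∈ C) (hcard : C.card ≤ ⌊(2 : ℝ) ^ ((n : ℝ) * R)⌋₊) :
    ∃ q : QuantScheme n R, q.expDist S ≤ n * wfDistAt hS t +
      √((∫ x, x ^ 4 ∂gaussianReal 0 1) * (piGaussian (Fin n)).real
        {w | ∀ y ∈ C, floodedDist hS.isHermitian.eigenvalues t w <
          weightedSqDist hS.isHermitian.eigenvalues w y}) * S.trace := by
  classical
  set l := hS.isHermitian.eigenvalues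
  set toCoord := eigenCoord hS.isHermitian
  have hbad : MeasurableSet {w | ∀ y ∈ C, floodedDist l t w < weightedSqDist l w y} := by
    have hInter : {w | ∀ y ∈ C, floodedDist l t w < weightedSqDist l w y} =
        ⋂ y ∈ C, {w | floodedDist l t w < weightedSqDist l w y} := by
      ext w
      simp only [Set.mem_ofPred_eq, Set.mem_iInter]
    rw [hInter]
    exact C.measurableSet_biInter fun y _ =>
      measurableSet_lt (measurable_floodedDist l t)
        (measurable_weightedSqDist l measurable_id measurable_const)
  obtain ⟨q, hq⟩ := exists_quantScheme_of_codebook (R := R) S (C := C.image toCoord.symm)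
    ⟨_, Finset.mem_image_of_mem _ hC⟩ (Finset.card_image_le.trans hcard)
  have hnearest (w : Fin n → ℝ) (y : Fin n → ℝ) (hy : y ∈ C) :
      weightedSqDist l w (toCoord (q.dec (q.enc (toCoord.symm w)))) ≤ weightedSqDist l w y := by
    simpa only [quadDist_eq_weightedSqDist hS.isHermitian, toCoord,
      MeasurableEquiv.apply_symm_apply]
      using hq (toCoord.symm w) _ (Finset.mem_image_of_mem _ hy)
  refine ⟨q, ?_⟩
  rw [QuantScheme.expDist, mul_wfDistAt, trace_eq_sum_eigenvalues_real hS.isHermitian,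
    integral_quadDist_eq_integral_weightedSqDist hS.isHermitian fun w => q.dec (q.enc w)]
  refine integral_le_sum_min_add hS.eigenvalues_nonneg ht hbad
    (fun w => weightedSqDist_nonneg hS.eigenvalues_nonneg _ _)
    (fun w => (hnearest w 0 hC).trans_eq (weightedSqDist_zero_right l w)) fun w hw => ?_
  simp only [Set.mem_ofPred_eq, not_forall, not_lt] at hw
  obtain ⟨y, hy, hclose⟩ := hw
  exact (hnearest w y hy).trans hclose

lemma exists_quantScheme_expDist_le_of_rate_gap (hS : S.PosSemidef) (ht : 0 < t) {a b θ : ℝ}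
    (ha : 0 ≤ a) (hb : 0 ≤ b) (hθ : 0 ≤ θ) (hθ' : θ ≤ 1 / 4)
    (hgap : Real.exp (n * wfRateAt hS t * Real.log 2 + 3 * a / 2) * (b + 2) ≤
      (2 : ℝ) ^ ((n : ℝ) * R)) :
    ∃ q : QuantScheme n R, q.expDist S ≤ n * wfDistAt hS t +
      √((∫ x, x ^ 4 ∂gaussianReal 0 1) *
        (3 * Real.exp (4 * n * θ ^ 2 - θ * a) + Real.exp (-b))) * S.trace := by
  set K := Real.exp (n * wfRateAt hS t * Real.log 2 + 3 * a / 2)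
  have hK : 1 ≤ K := Real.one_le_exp <| by
    have := waterNats_nonneg hS.isHermitian.eigenvalues t
    rw [mul_wfRateAt_mul_log_two]
    positivity
  obtain ⟨m, hm⟩ : ∃ m, ⌊(2 : ℝ) ^ ((n : ℝ) * R)⌋₊ = m + 1 :=
    Nat.exists_eq_succ_of_ne_zero (Nat.floor_pos.2 (by nlinarith)).ne'
  have hm_large : b ≤ m / K := by
    have hfloor := Nat.lt_floor_add_one ((2 : ℝ) ^ ((n : ℝ) * R))
    rw [hm] at hfloor
    push_cast at hfloor
    rw [le_div_iff₀ (by positivity)]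
    nlinarith
  obtain ⟨C, hC0, hcard, hC⟩ := exists_codebook hS.isHermitian.eigenvalues ht ha hθ hθ' m
  rw [← mul_wfRateAt_mul_log_two hS, Fintype.card_fin] at hC
  obtain ⟨q, hq⟩ := exists_quantScheme_expDist_le_of_codebook (R := R) hS ht.le hC0
    (hcard.trans hm.ge)
  have hmiss : (1 - K⁻¹) ^ m ≤ Real.exp (-b) :=
    (one_sub_inv_pow_le_exp hK m).trans (Real.exp_le_exp.2 (neg_le_neg hm_large))
  have htrace := hS.trace_nonneg
  have : 0 ≤ ∫ x, x ^ 4 ∂gaussianReal 0 1 := integral_nonneg fun x => by positivity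
  refine ⟨q, hq.trans ?_⟩
  gcongr
  exact hC.trans (by gcongr)

lemma half_le_log_natCast (hn : 2 ≤ n) : 1 / 2 ≤ Real.log n := calc
  1 / 2 ≤ Real.log 2 := by linarith [Real.log_two_gt_d9]
  _ ≤ Real.log n := Real.log_le_log two_pos (by exact_mod_cast hn)

lemma log_natCast_le_sqrt_mul_log (n : ℕ) : Real.log n ≤ √(n * Real.log n) :=
  Real.le_sqrt_of_sq_le <| by
    nlinarith [Real.log_le_self n.cast_nonneg, Real.log_natCast_nonneg n]

lemma half_sqrt_mul_log_le (n : ℕ) :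
    √(n * Real.log n) / 2 ≤ n * √(Real.logb 2 n / n) * Real.log 2 := by
  rcases n.eq_zero_or_pos with rfl | hn
  · simp
  have hlog_two : 1 / 4 ≤ Real.log 2 := by linarith [Real.log_two_gt_d9]
  refine (pow_le_pow_iff_left₀ (by positivity) (by positivity) two_ne_zero).1 ?_
  rw [Real.logb, div_pow, mul_pow, mul_pow, Real.sq_sqrt (by positivity),
    Real.sq_sqrt (by positivity)]
  field_simp
  nlinarith [Real.log_natCast_nonneg n]

lemma exp_mul_le_two_rpow {B c r : ℝ} (hn : 2 ≤ n) (hB : 0 ≤ B) (hc : 28 * B + 7 ≤ c)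
    (hr : r = R - c * √(Real.logb 2 n / n)) :
    Real.exp (n * r * Real.log 2 + 3 * ((8 * B + 1) * √(n * Real.log n)) / 2) *
      (2 * B * Real.log n + 2) ≤ (2 : ℝ) ^ ((n : ℝ) * R) := by
  set σ := √(n * Real.log n)
  have hσ : Real.log n ≤ σ := log_natCast_le_sqrt_mul_log n
  have hlog := half_le_log_natCast hn
  have hexponent : n * r * Real.log 2 + 3 * ((8 * B + 1) * σ) / 2 + (2 * B + 2) * σ ≤
      Real.log 2 * (n * R) := by
    have hbackoff : (28 * B + 7) * (σ / 2) ≤ c * (n * √(Real.logb 2 n / n) * Real.log 2) := by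
      gcongr
      · linarith
      · exact half_sqrt_mul_log_le n
    rw [hr]
    linarith
  calc _ ≤ Real.exp (n * r * Real.log 2 + 3 * ((8 * B + 1) * σ) / 2) *
          Real.exp ((2 * B + 2) * σ) := by
        gcongr
        nlinarith [Real.add_one_le_exp ((2 * B + 2) * σ)]
    _ ≤ Real.exp (Real.log 2 * (n * R)) := by
        rw [← Real.exp_add]
        exact Real.exp_le_exp.2 hexponent
    _ = _ := (Real.rpow_def_of_pos two_pos _).symm

lemma exists_quantScheme_expDist_le_of_wfRateAt_eq {B c : ℝ} (hn : 2 ≤ n) (hB : 0 ≤ B)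
    (hc : 28 * B + 7 ≤ c) (hS : S.PosSemidef) (ht : 0 < t)
    (hrate : wfRateAt hS t = R - c * √(Real.logb 2 n / n)) :
    ∃ q : QuantScheme n R, q.expDist S ≤ n * wfDistAt hS t +
      2 * √(∫ x, x ^ 4 ∂gaussianReal 0 1) * (n : ℝ) ^ (-B) * S.trace := by
  have hn0 : (0 : ℝ) < n := by positivity
  set σ := √(n * Real.log n)
  have hσ : σ ^ 2 = n * Real.log n := Real.sq_sqrt (by positivity)
  have hσn : σ ≤ n := Real.sqrt_le_iff.2 ⟨hn0.le, by nlinarith [Real.log_le_self hn0.le]⟩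
  obtain ⟨q, hq⟩ := exists_quantScheme_expDist_le_of_rate_gap hS ht
    (a := (8 * B + 1) * σ) (b := 2 * B * Real.log n) (θ := σ / (4 * n)) (by positivity)
    (by positivity) (by positivity)
    (by rw [div_le_div_iff₀ (by positivity) (by norm_num)]; linarith)
    (exp_mul_le_two_rpow hn hB hc hrate)
  -- The choice of `θ` makes both `4 * n * θ ^ 2` and `θ * σ` equal to `log n / 4`.
  have hexponent : 4 * n * (σ / (4 * n)) ^ 2 - σ / (4 * n) * ((8 * B + 1) * σ) =
      -(2 * B * Real.log n) := by
    field_simp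
    rw [hσ]
    ring
  have hpow : Real.exp (-(2 * B * Real.log n)) = ((n : ℝ) ^ (-B)) ^ 2 := by
    rw [Real.rpow_def_of_pos hn0, ← Real.exp_nat_mul]
    congr 1
    push_cast
    ring
  have hsqrt (M : ℝ) : √(M * (3 * ((n : ℝ) ^ (-B)) ^ 2 + ((n : ℝ) ^ (-B)) ^ 2)) =
      2 * √M * (n : ℝ) ^ (-B) := by
    rw [show M * (3 * ((n : ℝ) ^ (-B)) ^ 2 + ((n : ℝ) ^ (-B)) ^ 2) =
      M * (2 * (n : ℝ) ^ (-B)) ^ 2 by ring, Real.sqrt_mul' _ (sq_nonneg _),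
      Real.sqrt_sq (by positivity)]
    ring
  rw [hexponent, hpow, hsqrt] at hq
  exact ⟨q, hq⟩

lemma exists_quantScheme_expDist_le_wfDist {B c : ℝ} (hB : 0 ≤ B) (hc : 28 * B + 7 ≤ c)
    (hc' : 2 * √(∫ x, x ^ 4 ∂gaussianReal 0 1) ≤ c) (hn : 0 < n) (hR : 0 ≤ R)
    (hS : S.PosSemidef) :
    ∃ q : QuantScheme n R, q.expDist S ≤
      n * wfDist (R - c * √(Real.logb 2 n / n)) hS + c * (n : ℝ) ^ (-B) * S.trace := by
  have hn0 : (0 : ℝ) < n := by positivity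
  have htrace := hS.trace_nonneg
  obtain ⟨q, hq⟩ := exists_quantScheme_expDist_le_trace hR hS
  by_cases hlevel : ∃ t, 0 < t ∧ wfRateAt hS t = R - c * √(Real.logb 2 n / n)
  swap
  · refine ⟨q, hq.trans ?_⟩
    rw [wfDist_of_not_exists hS hlevel, mul_div_cancel₀ _ hn0.ne']
    exact le_add_of_nonneg_right (mul_nonneg (mul_nonneg (by linarith) (by positivity)) htrace)
  obtain ⟨t, ht, hrate⟩ := hlevel
  rw [wfDist_eq hS ht hrate]
  rcases (show 1 ≤ n from hn).eq_or_lt with rfl | hn2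
  · refine ⟨q, hq.trans ?_⟩
    have hdist : 0 ≤ ((1 : ℕ) : ℝ) * wfDistAt hS t := by
      rw [mul_wfDistAt]
      exact Finset.sum_nonneg fun i _ => le_min (hS.eigenvalues_nonneg i) ht.le
    rw [Nat.cast_one, Real.one_rpow, mul_one]
    push_cast at hdist
    nlinarith
  · obtain ⟨q', hq'⟩ := exists_quantScheme_expDist_le_of_wfRateAt_eq hn2 hB hc hS ht hrate
    exact ⟨q', hq'.trans (by gcongr)⟩

end Achievability

theorem mainTheorem6 :
    (∀ (n : ℕ), 0 < n → ∀ (R : ℝ) (S : Matrix (Fin n) (Fin n) ℝ) (hS : S.PosSemidef)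
      (q : QuantScheme n R), (n : ℝ) * wfDist R hS ≤ q.expDist S) ∧
    (∀ B : ℝ, 0 < B → ∃ c : ℝ, 0 < c ∧
      ∀ (n : ℕ), 0 < n → ∀ (R : ℝ), 0 ≤ R →
        ∀ (S : Matrix (Fin n) (Fin n) ℝ) (hS : S.PosSemidef),
          ∃ q : QuantScheme n R,
            q.expDist S ≤
              (n : ℝ) * wfDist (R - c * Real.sqrt (Real.logb 2 n / n)) hS +
                c * (n : ℝ) ^ (-B) * S.trace) :=
  ⟨fun _ hn _ _ hS q => wfDist_le_expDist hn hS q, fun B hB =>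
    ⟨max (28 * B + 7) (2 * √(∫ x, x ^ 4 ∂gaussianReal 0 1)),
      lt_max_of_lt_left (by positivity), fun _ hn _ hR _ hS =>
        exists_quantScheme_expDist_le_wfDist hB.le (le_max_left _ _) (le_max_right _ _) hn hR hS⟩⟩
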